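/- For $\theta\in\mathbb{R}$ let $m_0^{(\theta)}(z)=\sum_{k=0}^{3}a_kz^k$, where $$a_0=\tfrac{1-\cos\theta+\sin\theta}{2\sqrt2},\quad a_1=\tfrac{1-\cos\theta-\sin\theta}{2\sqrt2},\quad a_2=\tfrac{1+\cos\theta-\sin\theta}{2\sqrt2},\quad a_3=\tfrac{1+\cos\theta+\sin\theta}{2\sqrt2}$$ (the genus-2 family of low-pass filters). Let $Z_\theta=\{z\in\mathbb{T}: m_0^{(\theta)}(-z)=0\}$. A cycle of $z\mapsto z^2$ is a set of $n\ge1$ distinct points $z_1,\dots,z_n\in\mathbb{T}$ with $z_{i+1}=z_i^2$ for $1\le i<n$ and $z_n^2=z_1$; it is nontrivial if it is not $\{1\}$. A scaling function of $m_0^{(\theta)}$ is a function $\varphi\in L^2(\mathbb{R})$ vanishing a.e. outside $[0,3]$ with $\frac1{\sqrt2}\varphi(x/2)=\sum_{k=0}^3a_k\varphi(x-k)$ and $\int\varphi=1$. Its mother function is $\psi(x)=\sqrt2\sum_{k=0}^3(-1)^ka_{3-k}\varphi(2x-k)$, and $\psi_{j,k}(x)=2^{-j/2}\psi(2^{-j}x-k)$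 for $j,k\in\mathbb{Z}$. A family $(v_i)$ in a Hilbert space is a tight frame if for some $A>0$, $\sum_i|\langle v_i,f\rangle|^2=A\|f\|^2$ for all $f$. For every $\theta\in\mathbb{R}$: (1) $\{z\in\mathbb{T}:|m_0^{(\theta)}(z)|=\sqrt2\}=Z_\theta$, and $Z_\theta$ contains a nontrivial cycle of $z\mapsto z^2$ if and only if $\theta\equiv\pi/2 \pmod{2\pi}$. In that case $m_0^{(\theta)}(z)=(1+z^3)/\sqrt2$ and $Z_\theta$ consists of the three cube roots of $1$. (2) A scaling function of $m_0^{(\theta)}$ exists, and for every scaling function $\varphi$ the family $\{\psi_{j,k}\}_{j,k\in\mathbb{Z}}$ is a tight frame for $L^2(\mathbb{R})$; it is an orthonormal basis of $L^2(\mathbb{R})$ if and only if $\theta\not\equiv\pi/2\pmod{2\pi}$. Thus $\theta=\pi/2$ is the unique point of the family at which the wavelet system is a tight frame but not an orthonormal basis. (3) For every scaling function $\varphi$, the integer translates $\{\varphi(\cdot-k)\}_{k\in\mathbb{Z}}$ are orthonormal if and only if $\theta\not\equiv\pi/2\pmod{2\pi}$, and they are mutually orthogonal if and only if $\theta\not\equiv\pi/2\pmod{2\pi}$.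 -/

import Mathlib

open MeasureTheory

noncomputable section

namespace GenusTwo

/-- The coefficients `a₀, a₁, a₂, a₃` of the genus-2 family. -/
def coeff (θ : ℝ) : Fin 4 → ℝ :=
  ![(1 - Real.cos θ + Real.sin θ) / (2 * √2),
    (1 - Real.cos θ - Real.sin θ) / (2 * √2),
    (1 + Real.cos θ - Real.sin θ) / (2 * √2),
    (1 + Real.cos θ + Real.sin θ) / (2 * √2)]

/-- The low-pass filter `m₀^(θ)(z) = a₀ + a₁ z + a₂ z² + a₃ z³`. -/
def lowPass (θ : ℝ) (z : ℂ) : ℂ :=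
  ∑ k : Fin 4, (coeff θ k : ℂ) * z ^ (k : ℕ)

/-- The subset `{z : m₀^(θ)(-z) = 0}` of the unit circle. -/
def zeroSet (θ : ℝ) : Set Circle :=
  {z | lowPass θ (-(z : ℂ)) = 0}

/-- A cycle of the doubling map `z ↦ z²` on the circle: a set of `n ≥ 1` distinct points
`z₀ → z₁ → ⋯ → z_{n-1} → z₀`. -/
def IsCycle (C : Set Circle) : Prop :=
  ∃ (n : ℕ) (z : ℕ → Circle), 0 < n ∧ (∀ i, z (i + 1) = z i ^ 2) ∧ z n = z 0 ∧
    Set.InjOn z {i | i < n} ∧ C = z '' {i | i < n}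

/-- A nontrivial cycle is a cycle other than `{1}`. -/
def IsNontrivialCycle (C : Set Circle) : Prop :=
  IsCycle C ∧ C ≠ {1}

/-- The complex Hilbert space `L²(ℝ)`. -/
abbrev L2R : Type := Lp ℂ 2 (volume : Measure ℝ)

theorem memLp_comp_affine (f : L2R) {a : ℝ} (ha : a ≠ 0) (b : ℝ) (c : ℂ) :
    MemLp (fun x : ℝ => c * f (a * x - b)) 2 volume := by
  have h1 : MemLp (fun y : ℝ => f (y - b)) 2 volume :=
    (Lp.memLp f).comp_measurePreserving (measurePreserving_sub_right volume b)
  have h2 : MemLp (fun y : ℝ => f (y - b)) 2 (Measure.map (fun x : ℝ => a * x) volume) := by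
    rw [Real.map_volume_mul_left ha]
    exact h1.smul_measure ENNReal.ofReal_ne_top
  exact (h2.comp_of_map (measurable_const_mul a).aemeasurable).const_mul c

/-- `f_{j,k}(x) = 2^{-j/2} f(2^{-j} x - k)` as an element of `L²(ℝ)`. Thus `dilTrans 0 k` is
translation by `k`, and `dilTrans 1 0` is the unitary scaling `f ↦ 2^{-1/2} f(x/2)`. -/
def dilTrans (j k : ℤ) (f : L2R) : L2R :=
  (memLp_comp_affine f (zpow_ne_zero (-j) (two_ne_zero : (2 : ℝ) ≠ 0)) (k : ℝ)
    (((2 : ℝ) ^ (-(j : ℝ) / 2) : ℝ) : ℂ)).toLp _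

/-- `φ` is the scaling (father) function of `m₀^(θ)`: it lies in `L²(ℝ)`, is supported in `[0,3]`,
satisfies `2^{-1/2} φ(x/2) = ∑ₖ aₖ φ(x - k)`, and is normalized by `∫ φ = 1`, that is,
`φ̂(0) = (2π)^{-1/2}`. -/
structure IsScalingFunction (θ : ℝ) (φ : L2R) : Prop where
  supported : ∀ᵐ x : ℝ, x ∉ Set.Icc (0 : ℝ) 3 → φ x = 0
  scaling : dilTrans 1 0 φ = ∑ k : Fin 4, (coeff θ k : ℂ) • dilTrans 0 (k : ℕ) φ
  normalized : ∫ x : ℝ, φ x = 1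

/-- The mother function `ψ(x) = √2 ∑ₖ (-1)^k a_{3-k} φ(2x - k)`. -/
def mother (θ : ℝ) (φ : L2R) : L2R :=
  ∑ k : Fin 4, ((-1 : ℂ) ^ (k : ℕ) * (coeff θ k.rev : ℂ)) • dilTrans (-1) (k : ℕ) φ

/-- The wavelet system `ψ_{j,k}(x) = 2^{-j/2} ψ(2^{-j} x - k)`, `j, k ∈ ℤ`. -/
def waveletSystem (θ : ℝ) (φ : L2R) (p : ℤ × ℤ) : L2R :=
  dilTrans p.1 p.2 (mother θ φ)

/-- The integer translates `φ(x - k)`, `k ∈ ℤ`. -/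
def translates (φ : L2R) (k : ℤ) : L2R :=
  dilTrans 0 k φ

/-- A tight frame of a Hilbert space: for some `A > 0`,
`∑ᵢ |⟨vᵢ, f⟩|² = A ‖f‖²` for all `f`. -/
def IsTightFrame {ι H : Type*} [NormedAddCommGroup H] [InnerProductSpace ℂ H] (v : ι → H) : Prop :=
  ∃ A : ℝ, 0 < A ∧ ∀ f : H, HasSum (fun i => ‖inner ℂ (v i) f‖ ^ 2) (A * ‖f‖ ^ 2)

/-- An orthonormal (Hilbert) basis of a Hilbert space. -/
def IsOrthonormalBasis {ι H : Type*} [NormedAddCommGroup H] [InnerProductSpace ℂ H]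
    (v : ι → H) : Prop :=
  ∃ b : HilbertBasis ι ℂ H, (b : ι → H) = v

end GenusTwo

end

namespace GenusTwo

open Filter Topology

/-! Let `scaleSum φ j f` be the sum over `k` of `|⟨φ_{j,k}, f⟩|²`. The filters `a_k` and `(-1)^k
a_{3-k}` form an `ℓ²`-isometric filter bank (`hasSum_filter`), so for a solution of the scaling
equation the wavelet coefficients at scale `j` contribute exactly `scaleSum φ (j-1) f - scaleSum φ j
f` (`hasSum_mother`). This telescopes: the sums tend to `0` at coarse scales and to `|∫ φ|² ‖f‖²` at
fine ones, so `∫ φ = 1` gives a Parseval frame for every `θ`. The same monotonicity shows that a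
supported solution with zero integral vanishes.

A Parseval frame is an orthonormal basis exactly when its vectors are unit vectors, and `‖ψ‖ = ‖φ‖`
always (`norm_mother`); hence everything depends on whether `‖φ‖ = 1`. The correlations `⟨φ, φ(· -
k)⟩` vanish for `|k| ≥ 3` and satisfy a small linear system that forces them to vanish for `k ≠ 0`
unless `sin θ = 1`. Orthogonality of the translates then gives `‖φ‖ = 1`
(`norm_eq_one_of_orthogonal`). If `sin θ = 1`, uniqueness identifies `φ` with one third of the
indicator of `[0,3]`, of squared norm `1/3`.

Existence comes from a weak limit of Cesàro means of the cascade iterates of the indicator of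
`(0,1]`, which all have norm one. The assertions on zeros rest on `|m₀(z)|² + |m₀(-z)|² = 2` and on
the factor `1 - z` of `m₀(-z)`. -/

/-! ### Dilation and translation operators. -/

theorem quasiMeasurePreserving_affine {a : ℝ} (ha : a ≠ 0) (b : ℝ) :
    Measure.QuasiMeasurePreserving (fun x : ℝ => a * x - b) volume volume := by
  have h1 : Measure.QuasiMeasurePreserving (fun x : ℝ => a * x) volume volume := by
    refine ⟨measurable_const_mul a, ?_⟩
    rw [Real.map_volume_mul_left ha]
    exact Measure.smul_absolutelyContinuous
  exact (measurePreserving_sub_right volume b).quasiMeasurePreserving.comp h1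

theorem ae_comp_affine {p : ℝ → Prop} (h : ∀ᵐ x, p x) {a : ℝ} (ha : a ≠ 0) (b : ℝ) :
    ∀ᵐ x, p (a * x - b) :=
  (quasiMeasurePreserving_affine ha b).ae h

theorem integral_comp_affine {E : Type*} [NormedAddCommGroup E] [NormedSpace ℝ E]
    (g : ℝ → E) (a b : ℝ) : ∫ x, g (a * x - b) = |a⁻¹| • ∫ x, g x := by
  rw [Measure.integral_comp_mul_left (fun y => g (y - b)) a, integral_sub_right_eq_self]

theorem two_zpow_ne_zero (j : ℤ) : (2 : ℝ) ^ j ≠ 0 := zpow_ne_zero _ two_ne_zero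

theorem coeFn_dilTrans (j k : ℤ) (f : L2R) :
    dilTrans j k f =ᵐ[volume] fun x : ℝ =>
      (((2 : ℝ) ^ (-(j : ℝ) / 2) : ℝ) : ℂ) * f ((2 : ℝ) ^ (-j) * x - k) :=
  MemLp.coeFn_toLp _

theorem sq_two_rpow (j : ℤ) : ((2 : ℝ) ^ (-(j : ℝ) / 2)) ^ 2 = (2 : ℝ) ^ (-j) := by
  rw [← Real.rpow_natCast, ← Real.rpow_mul two_pos.le, ← Real.rpow_intCast]
  congr 1
  push_cast
  ring

theorem inner_dilTrans_dilTrans_self (j k : ℤ) (f g : L2R) :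
    inner ℂ (dilTrans j k f) (dilTrans j k g) = inner ℂ f g := by
  rw [L2.inner_def, L2.inner_def]
  have h : ∀ᵐ x : ℝ, inner ℂ (dilTrans j k f x) (dilTrans j k g x) =
      (fun y => (((2 : ℝ) ^ (-j) : ℝ) : ℂ) * inner ℂ (f y) (g y)) ((2 : ℝ) ^ (-j) * x - k) := by
    filter_upwards [coeFn_dilTrans j k f, coeFn_dilTrans j k g] with x hf hg
    rw [hf, hg, ← sq_two_rpow]
    simp only [RCLike.inner_apply, map_mul, Complex.conj_ofReal]
    push_cast
    ring
  rw [integral_congr_ae h, integral_comp_affine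
    (fun y => (((2 : ℝ) ^ (-j) : ℝ) : ℂ) * inner ℂ (f y) (g y))]
  rw [integral_const_mul, ← zpow_neg,
    abs_of_pos (by positivity), Complex.real_smul, ← mul_assoc, ← Complex.ofReal_mul,
    ← zpow_add₀ two_ne_zero]
  simp

theorem dilTrans_add (j k : ℤ) (f g : L2R) :
    dilTrans j k (f + g) = dilTrans j k f + dilTrans j k g := by
  apply Lp.ext
  filter_upwards [coeFn_dilTrans j k f, coeFn_dilTrans j k g, coeFn_dilTrans j k (f + g),
    Lp.coeFn_add (dilTrans j k f) (dilTrans j k g),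
    ae_comp_affine (Lp.coeFn_add f g) (two_zpow_ne_zero (-j)) k] with x h1 h2 h3 h4 h5
  rw [h3, h4, Pi.add_apply, h1, h2, h5, Pi.add_apply, mul_add]

theorem dilTrans_smul (j k : ℤ) (c : ℂ) (f : L2R) :
    dilTrans j k (c • f) = c • dilTrans j k f := by
  apply Lp.ext
  filter_upwards [coeFn_dilTrans j k f, coeFn_dilTrans j k (c • f),
    Lp.coeFn_smul c (dilTrans j k f),
    ae_comp_affine (Lp.coeFn_smul c f) (two_zpow_ne_zero (-j)) k] with x h1 h2 h3 h4
  rw [h2, h3, Pi.smul_apply, h1, h4, Pi.smul_apply, smul_eq_mul, smul_eq_mul]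
  ring

/-- `dilTrans j k` as a linear isometry of `L²(ℝ)`. -/
noncomputable def dilTransIsometry (j k : ℤ) : L2R →ₗᵢ[ℂ] L2R where
  toFun := dilTrans j k
  map_add' := dilTrans_add j k
  map_smul' := dilTrans_smul j k
  norm_map' f := by
    change ‖dilTrans j k f‖ = ‖f‖
    rw [norm_eq_sqrt_re_inner (𝕜 := ℂ), norm_eq_sqrt_re_inner (𝕜 := ℂ),
      inner_dilTrans_dilTrans_self]

@[simp] theorem dilTransIsometry_apply (j k : ℤ) (f : L2R) :
    dilTransIsometry j k f = dilTrans j k f := rfl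

theorem dilTrans_sub (j k : ℤ) (f g : L2R) :
    dilTrans j k (f - g) = dilTrans j k f - dilTrans j k g :=
  map_sub (dilTransIsometry j k) f g

theorem dilTrans_sum {ι : Type*} (s : Finset ι) (j k : ℤ) (f : ι → L2R) :
    dilTrans j k (∑ i ∈ s, f i) = ∑ i ∈ s, dilTrans j k (f i) :=
  map_sum (dilTransIsometry j k) f s

theorem norm_dilTrans (j k : ℤ) (f : L2R) : ‖dilTrans j k f‖ = ‖f‖ :=
  (dilTransIsometry j k).norm_map f

/-- The composite translation `2^{-j'} k + k'` need not be an integer when `j' > 0`, hence the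
parameter `m` with its hypothesis. -/
theorem dilTrans_dilTrans (j k j' k' m : ℤ) (hm : (m : ℝ) = (2 : ℝ) ^ (-j') * k + k') (f : L2R) :
    dilTrans j k (dilTrans j' k' f) = dilTrans (j + j') m f := by
  apply Lp.ext
  filter_upwards [coeFn_dilTrans j k (dilTrans j' k' f), coeFn_dilTrans (j + j') m f,
    ae_comp_affine (coeFn_dilTrans j' k' f) (two_zpow_ne_zero (-j)) k] with x h1 h2 h3
  have harg : (2 : ℝ) ^ (-j') * ((2 : ℝ) ^ (-j) * x - k) - k' = (2 : ℝ) ^ (-(j + j')) * x - m := by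
    rw [hm, neg_add, zpow_add₀ two_ne_zero]
    ring
  have hexp : -(j : ℝ) / 2 + -(j' : ℝ) / 2 = -((j + j' : ℤ) : ℝ) / 2 := by
    push_cast
    ring
  rw [h1, h2, h3, ← mul_assoc, ← Complex.ofReal_mul, ← Real.rpow_add two_pos, harg, hexp]

theorem dilTrans_zero_zero (f : L2R) : dilTrans 0 0 f = f := by
  apply Lp.ext
  filter_upwards [coeFn_dilTrans 0 0 f] with x h
  rw [h]
  simp

theorem dilTrans_zero_right_dilTrans (j j' k : ℤ) (f : L2R) :
    dilTrans j 0 (dilTrans j' k f) = dilTrans (j + j') k f :=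
  dilTrans_dilTrans _ _ _ _ _ (by simp) f

theorem dilTrans_dilTrans_zero (j k l : ℤ) (f : L2R) :
    dilTrans j k (dilTrans 0 l f) = dilTrans j (k + l) f := by
  simpa using dilTrans_dilTrans j k 0 l (k + l) (by simp) f

theorem dilTrans_dilTrans_neg_one (j k l : ℤ) (f : L2R) :
    dilTrans j k (dilTrans (-1) l f) = dilTrans (j - 1) (2 * k + l) f :=
  dilTrans_dilTrans j k (-1) l (2 * k + l) (by norm_num) f

theorem inner_dilTrans_dilTrans (j k l : ℤ) (f g : L2R) :
    inner ℂ (dilTrans j k f) (dilTrans j l g) = inner ℂ f (dilTrans 0 (l - k) g) := by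
  rw [← inner_dilTrans_dilTrans_self j k f, dilTrans_dilTrans_zero]
  congr 2
  ring

/-- Moving the dilation onto `g` reduces estimates at scale `j` to scale `0`. -/
theorem inner_dilTrans_left (j k : ℤ) (f g : L2R) :
    inner ℂ (dilTrans j k f) g = inner ℂ (dilTrans 0 k f) (dilTrans (-j) 0 g) := by
  rw [← inner_dilTrans_dilTrans_self (-j) 0 (dilTrans j k f), dilTrans_zero_right_dilTrans]
  simp

/-! ### Supported functions and localization. -/

/-- The functions in `L²(ℝ)` that vanish almost everywhere outside `[0,3]`. -/
def IsSupported (f : L2R) : Prop :=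
  ∀ᵐ x : ℝ, x ∉ Set.Icc (0 : ℝ) 3 → f x = 0

/-- The inner product with `η_{j,k}` is an integral over the fundamental interval. -/
theorem inner_dilTrans_eq_integral (η f : L2R) (j k : ℤ) :
    inner ℂ (dilTrans j k η) f = (((2 : ℝ) ^ ((j : ℝ) / 2) : ℝ) : ℂ) *
      ∫ y, inner ℂ (η y) (f ((2 : ℝ) ^ j * (y + k))) := by
  rw [L2.inner_def]
  have h : ∀ᵐ x : ℝ, inner ℂ (dilTrans j k η x) (f x) =
      (fun y => (((2 : ℝ) ^ (-(j : ℝ) / 2) : ℝ) : ℂ) * inner ℂ (η y) (f ((2 : ℝ) ^ j * (y + k))))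
        ((2 : ℝ) ^ (-j) * x - k) := by
    filter_upwards [coeFn_dilTrans j k η] with x hf
    have : (2 : ℝ) ^ j * ((2 : ℝ) ^ (-j) * x - k + k) = x := by
      rw [sub_add_cancel, ← mul_assoc, ← zpow_add₀ two_ne_zero]
      simp
    simp only [this]
    rw [hf]
    simp only [RCLike.inner_apply, map_mul, Complex.conj_ofReal]
    ring
  rw [integral_congr_ae h, integral_comp_affine
    (fun y => (((2 : ℝ) ^ (-(j : ℝ) / 2) : ℝ) : ℂ) * inner ℂ (η y) (f ((2 : ℝ) ^ j * (y + k))))]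
  rw [integral_const_mul, ← zpow_neg, neg_neg,
    abs_of_pos (by positivity), Complex.real_smul, ← mul_assoc, ← Complex.ofReal_mul,
    ← Real.rpow_intCast, ← Real.rpow_add two_pos]
  congr 4
  ring

theorem integral_dilTrans_neg_one (k : ℤ) (f : L2R) :
    ∫ x, dilTrans (-1) k f x = ((√2)⁻¹ : ℂ) * ∫ x, f x := by
  rw [integral_congr_ae (coeFn_dilTrans (-1) k f), integral_const_mul,
    integral_comp_affine (fun y => f y) _ _, Complex.real_smul, ← mul_assoc]
  congr 1
  have h : (2 : ℝ) ^ (-((-1 : ℤ) : ℝ) / 2) = √2 := by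
    rw [Real.sqrt_eq_rpow]
    norm_num
  rw [h, ← Complex.ofReal_mul]
  rw [← Complex.ofReal_inv]
  congr 1
  norm_num
  have h2 : √2 * √2 = 2 := Real.mul_self_sqrt (by norm_num)
  field_simp
  linarith

theorem norm_sq_eq_integral (f : L2R) : ‖f‖ ^ 2 = ∫ x, ‖f x‖ ^ 2 := by
  have h := L2.inner_def (𝕜 := ℂ) f f
  simp only [inner_self_eq_norm_sq_to_K] at h
  have h2 : (((∫ x, ‖f x‖ ^ 2 : ℝ)) : ℂ) = ∫ x, ((‖f x‖ : ℂ)) ^ 2 := by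
    rw [← integral_complex_ofReal]
    push_cast
    rfl
  apply Complex.ofReal_injective
  rw [h2]
  push_cast
  exact h

theorem integrable_norm_sq (f : L2R) : Integrable fun x => ‖f x‖ ^ 2 :=
  (Lp.memLp f).integrable_norm_pow two_ne_zero

/-- Multiplication of `f ∈ L²(ℝ)` by the indicator function of a measurable set. -/
noncomputable def restrictTo {s : Set ℝ} (hs : MeasurableSet s) (f : L2R) : L2R :=
  ((Lp.memLp f).indicator hs).toLp _

theorem coeFn_restrictTo {s : Set ℝ} (hs : MeasurableSet s) (f : L2R) :
    restrictTo hs f =ᵐ[volume] s.indicator f :=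
  MemLp.coeFn_toLp _

theorem norm_sq_restrictTo {s : Set ℝ} (hs : MeasurableSet s) (f : L2R) :
    ‖restrictTo hs f‖ ^ 2 = ∫ x in s, ‖f x‖ ^ 2 := by
  rw [norm_sq_eq_integral, ← integral_indicator hs]
  apply integral_congr_ae
  filter_upwards [coeFn_restrictTo hs f] with x hx
  rw [hx]
  by_cases h : x ∈ s <;> simp [h]

theorem inner_restrictTo {s : Set ℝ} (hs : MeasurableSet s) (f g : L2R)
    (hf : ∀ᵐ x : ℝ, x ∉ s → f x = 0) : inner ℂ f (restrictTo hs g) = inner ℂ f g := by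
  rw [L2.inner_def, L2.inner_def]
  apply integral_congr_ae
  filter_upwards [coeFn_restrictTo hs g, hf] with x hx h0
  rw [hx]
  by_cases h : x ∈ s <;> simp [h, h0]

/-- Discarding the null endpoint leaves half-open intervals, which split into unit pieces tiling the
line. -/
theorem IsSupported.dilTrans_zero {η : L2R} (hη : IsSupported η) (k : ℤ) :
    ∀ᵐ x : ℝ, x ∉ Set.Ioc (k : ℝ) (k + 3) → dilTrans 0 k η x = 0 := by
  have hk : ∀ᵐ x : ℝ, x ≠ k := by
    rw [ae_iff]
    simp
  filter_upwards [coeFn_dilTrans 0 k η, ae_comp_affine hη (two_zpow_ne_zero (-0)) k, hk]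
    with x h1 h2 h3 hx
  rw [h1, h2, mul_zero]
  simp only [neg_zero, zpow_zero, one_mul, Set.mem_Icc, Set.mem_Ioc] at hx ⊢
  rintro ⟨h4, h5⟩
  exact hx ⟨lt_of_le_of_ne (by linarith) (Ne.symm h3), by linarith⟩

theorem hasSum_integral_Ioc {g : ℝ → ℝ} (hg : Integrable g) (b : ℝ) :
    HasSum (fun k : ℤ => ∫ x in Set.Ioc ((k : ℝ) + b) (k + b + 1), g x) (∫ x, g x) := by
  have h := hasSum_integral_iUnion (μ := volume) (f := g)
    (s := fun k : ℤ => Set.Ioc (b + k) (b + k + 1))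
    (fun _ => measurableSet_Ioc) (Set.pairwise_disjoint_Ioc_add_intCast b)
    (by rw [iUnion_Ioc_add_intCast]; exact hg.integrableOn)
  rw [iUnion_Ioc_add_intCast, setIntegral_univ] at h
  simpa only [add_comm b] using h

/-- Every point lies in exactly three of the intervals `(k, k+3]`; this overlap is the `3` in
`IsSupported.scaleSum_le`. -/
theorem hasSum_integral_Ioc_three {g : ℝ → ℝ} (hg : Integrable g) :
    HasSum (fun k : ℤ => ∫ x in Set.Ioc (k : ℝ) (k + 3), g x) (3 * ∫ x, g x) := by
  have h := ((hasSum_integral_Ioc hg 0).add (hasSum_integral_Ioc hg 1)).add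
    (hasSum_integral_Ioc hg 2)
  convert h using 1
  · funext k
    have i1 : ∀ a b : ℝ, IntervalIntegrable g volume a b := fun a b => hg.intervalIntegrable
    rw [← intervalIntegral.integral_of_le (by linarith),
      ← intervalIntegral.integral_of_le (by linarith),
      ← intervalIntegral.integral_of_le (by linarith),
      ← intervalIntegral.integral_of_le (by linarith),
      ← intervalIntegral.integral_add_adjacent_intervals (i1 k (k + 2)) (i1 (k + 2) (k + 3)),
      ← intervalIntegral.integral_add_adjacent_intervals (i1 k (k + 1)) (i1 (k + 1) (k + 2))]
    norm_num [add_assoc]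
  · ring

theorem norm_sq_inner_dilTrans_zero_le {η : L2R} (hη : IsSupported η) (f : L2R) (k : ℤ) :
    ‖inner ℂ (dilTrans 0 k η) f‖ ^ 2 ≤
      ‖η‖ ^ 2 * ∫ x in Set.Ioc (k : ℝ) (k + 3), ‖f x‖ ^ 2 := by
  rw [← inner_restrictTo measurableSet_Ioc _ f (hη.dilTrans_zero k),
    ← norm_sq_restrictTo measurableSet_Ioc f, ← mul_pow, ← norm_dilTrans 0 k η]
  exact pow_le_pow_left₀ (norm_nonneg _) (norm_inner_le_norm _ _) 2

/-! ### Bessel bounds for one scale. -/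

/-- The sum `∑ₖ |⟨η_{j,k}, f⟩|²` over one scale. -/
noncomputable def scaleSum (η : L2R) (j : ℤ) (f : L2R) : ℝ :=
  ∑' k : ℤ, ‖inner ℂ (dilTrans j k η) f‖ ^ 2

theorem IsSupported.summable_zero {η : L2R} (hη : IsSupported η) (f : L2R) :
    Summable fun k : ℤ => ‖inner ℂ (dilTrans 0 k η) f‖ ^ 2 :=
  Summable.of_nonneg_of_le (fun _ => by positivity) (norm_sq_inner_dilTrans_zero_le hη f)
    ((hasSum_integral_Ioc_three (integrable_norm_sq f)).summable.mul_left _)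

theorem IsSupported.summable {η : L2R} (hη : IsSupported η) (j : ℤ) (f : L2R) :
    Summable fun k : ℤ => ‖inner ℂ (dilTrans j k η) f‖ ^ 2 := by
  simp_rw [inner_dilTrans_left j]
  exact hη.summable_zero _

theorem IsSupported.scaleSum_le {η : L2R} (hη : IsSupported η) (j : ℤ) (f : L2R) :
    scaleSum η j f ≤ 3 * ‖η‖ ^ 2 * ‖f‖ ^ 2 := by
  unfold scaleSum
  simp_rw [inner_dilTrans_left j]
  have h := (hasSum_integral_Ioc_three (integrable_norm_sq (dilTrans (-j) 0 f))).mul_left (‖η‖ ^ 2)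
  have h2 := (hη.summable_zero (dilTrans (-j) 0 f)).hasSum.tsum_eq ▸
    hasSum_le (norm_sq_inner_dilTrans_zero_le hη (dilTrans (-j) 0 f))
      (hη.summable_zero (dilTrans (-j) 0 f)).hasSum h
  rw [← norm_sq_eq_integral, norm_dilTrans] at h2
  linarith

/-- The coefficients `⟨η_{j,k}, f⟩`, `k ∈ ℤ`, as an element of `ℓ²(ℤ)`. -/
noncomputable def analysis {η : L2R} (hη : IsSupported η) (j : ℤ) : L2R →ₗ[ℂ] lp (fun _ : ℤ => ℂ) 2 where
  toFun f := ⟨fun k => inner ℂ (dilTrans j k η) f, by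
    apply memℓp_gen
    simpa using hη.summable j f⟩
  map_add' f g := by
    ext k
    exact inner_add_right _ _ _
  map_smul' c f := by
    ext k
    exact inner_smul_right _ _ _

theorem norm_analysis {η : L2R} (hη : IsSupported η) (j : ℤ) (f : L2R) :
    ‖analysis hη j f‖ = √(scaleSum η j f) := by
  rw [lp.norm_eq_tsum_rpow (by simp), Real.sqrt_eq_rpow]
  simp [analysis, scaleSum]

theorem scaleSum_nonneg (η : L2R) (j : ℤ) (f : L2R) : 0 ≤ scaleSum η j f :=
  tsum_nonneg fun _ => by positivity

/-- The square root is the `ℓ²` norm of a bounded linear map. Its Lipschitz constant does not depend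
on `j`, so limits in `j` need only be checked on a dense set. -/
theorem lipschitzWith_sqrt_scaleSum {η : L2R} (hη : IsSupported η) (j : ℤ) (f g : L2R) :
    |√(scaleSum η j f) - √(scaleSum η j g)| ≤ √3 * ‖η‖ * ‖f - g‖ := by
  rw [← norm_analysis hη, ← norm_analysis hη]
  refine (abs_norm_sub_norm_le _ _).trans ?_
  rw [← map_sub, norm_analysis]
  have h : √3 * ‖η‖ * ‖f - g‖ = √(3 * ‖η‖ ^ 2 * ‖f - g‖ ^ 2) := by
    rw [mul_assoc 3, ← mul_pow, Real.sqrt_mul (by norm_num), Real.sqrt_sq (by positivity), mul_assoc]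
  rw [h]
  exact Real.sqrt_le_sqrt (hη.scaleSum_le j _)

/-! ### Limits of the scale sums at fine and coarse scales. -/

theorem tendsto_of_lipschitz_of_dense {E : Type*} [SeminormedAddCommGroup E] {s : Set E}
    (hs : Dense s) {F : Type*} [SeminormedAddCommGroup F] {u : ℕ → E → F} {v : E → F} {K : ℝ}
    (hu : ∀ n f g, ‖u n f - u n g‖ ≤ K * ‖f - g‖) (hv : ∀ f g, ‖v f - v g‖ ≤ K * ‖f - g‖)
    (h : ∀ f ∈ s, Tendsto (fun n => u n f) atTop (𝓝 (v f))) (f : E) :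
    Tendsto (fun n => u n f) atTop (𝓝 (v f)) := by
  rw [Metric.tendsto_atTop]
  intro ε hε
  obtain ⟨g, hg, hfg⟩ := hs.exists_dist_lt f (show 0 < ε / (3 * (|K| + 1)) by positivity)
  rw [dist_eq_norm] at hfg
  have hK : K * ‖f - g‖ ≤ ε / 3 := by
    calc K * ‖f - g‖ ≤ (|K| + 1) * (ε / (3 * (|K| + 1))) :=
          mul_le_mul ((le_abs_self K).trans (by linarith)) hfg.le (norm_nonneg _) (by positivity)
      _ = ε / 3 := by field_simp
  obtain ⟨N, hN⟩ := Metric.tendsto_atTop.1 (h g hg) (ε / 3) (by positivity)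
  refine ⟨N, fun n hn => ?_⟩
  have h1 : dist (u n f) (u n g) ≤ ε / 3 := by
    rw [dist_eq_norm]
    exact (hu n f g).trans hK
  have h2 : dist (v g) (v f) ≤ ε / 3 := by
    rw [dist_comm, dist_eq_norm]
    exact (hv f g).trans hK
  have h3 := hN n hn
  have h4 := dist_triangle4 (u n f) (u n g) (v g) (v f)
  linarith

/-- The classes in `L²(ℝ)` of the continuous functions with compact support. -/
def compactlySupported : Set L2R :=
  {f | ∃ g : ℝ → ℂ, Continuous g ∧ HasCompactSupport g ∧ f =ᵐ[volume] g}

theorem dense_compactlySupported : Dense compactlySupported := by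
  intro f
  rw [EMetric.mem_closure_iff]
  intro ε hε
  obtain ⟨g, hg1, hg2, hg3, hg4⟩ := (Lp.memLp f).exists_hasCompactSupport_eLpNorm_sub_le
    (by simp) (ε := ε / 2) (ENNReal.half_pos hε.ne').ne'
  -- The strict inequality `ε / 2 < ε` fails for `ε = ⊤`.
  by_cases hε' : ε = ⊤
  · refine ⟨hg4.toLp g, ⟨g, hg3, hg1, hg4.coeFn_toLp⟩, ?_⟩
    rw [hε']
    exact edist_lt_top _ _
  · refine ⟨hg4.toLp g, ⟨g, hg3, hg1, hg4.coeFn_toLp⟩, ?_⟩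
    rw [Lp.edist_def]
    refine lt_of_le_of_lt ?_ (ENNReal.half_lt_self hε.ne' hε')
    refine (eLpNorm_congr_ae ?_).trans_le hg2
    filter_upwards [hg4.coeFn_toLp] with x hx
    simp [hx]

theorem exists_bound {g : ℝ → ℂ} (hg : Continuous g) (hc : HasCompactSupport g) :
    ∃ R M : ℝ, 0 ≤ R ∧ 0 ≤ M ∧ (∀ x, ‖g x‖ ≤ M) ∧ ∀ x, R < |x| → g x = 0 := by
  obtain ⟨M, hM⟩ := hc.exists_bound_of_continuous hg
  obtain ⟨R, hR⟩ := hc.isCompact.isBounded.subset_closedBall 0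
  refine ⟨max R 0, M, le_max_right _ _, (norm_nonneg _).trans (hM 0), hM, fun x hx => ?_⟩
  by_contra h
  have := hR (subset_tsupport g h)
  rw [mem_closedBall_zero_iff, Real.norm_eq_abs] at this
  exact absurd hx (not_lt.2 (this.trans (le_max_left _ _)))

theorem IsSupported.integrable {η : L2R} (hη : IsSupported η) : Integrable η := by
  have h : IntegrableOn η (Set.Icc (0 : ℝ) 3) :=
    ((Lp.memLp η).restrict _).integrable (by norm_num)
  rw [← integrable_indicator_iff measurableSet_Icc] at h
  refine h.congr ?_
  filter_upwards [hη] with x hx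
  by_cases hx' : x ∈ Set.Icc (0 : ℝ) 3
  · simp [hx']
  · simp [hx', hx hx']

/-- Turns a sum over `k` into the integral of a step function, so that dominated convergence applies
to it. -/
theorem integral_comp_floor {h : ℤ → ℝ} (h0 : ∀ k, 0 ≤ h k) (hs : Summable h) :
    ∫ x : ℝ, h ⌊x⌋ = ∑' k, h k := by
  have hc : ∀ k : ℤ, ∀ x ∈ Set.Ico (k : ℝ) (k + 1), h ⌊x⌋ = h k := fun k x hx => by
    rw [Int.floor_eq_iff.2 hx]
  have hint : ∀ k : ℤ, ∫ x in Set.Ico (k : ℝ) (k + 1), h ⌊x⌋ = h k := fun k => by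
    rw [setIntegral_congr_fun measurableSet_Ico (hc k)]
    simp
  have hio : ∀ k : ℤ, IntegrableOn (fun x : ℝ => h ⌊x⌋) (Set.Ico (k : ℝ) (k + 1)) := fun k => by
    rw [integrableOn_congr_fun (hc k) measurableSet_Ico]
    simp
  have hi : IntegrableOn (fun x : ℝ => h ⌊x⌋) (⋃ k : ℤ, Set.Ico (k : ℝ) (k + 1)) := by
    apply integrableOn_iUnion_of_summable_integral_norm hio
    refine hs.congr fun k => ?_
    rw [← hint k]
    exact integral_congr_ae (ae_of_all _ fun x => by simp [abs_of_nonneg (h0 _)])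
  have h2 := (hasSum_integral_iUnion (fun _ => measurableSet_Ico)
    (Set.pairwise_disjoint_Ico_intCast ℝ) hi).tsum_eq
  rw [iUnion_Ico_intCast, setIntegral_univ] at h2
  rw [← h2]
  exact tsum_congr hint

theorem inner_dilTrans_of_ae_eq (η : L2R) {f : L2R} {g : ℝ → ℂ} (hfg : f =ᵐ[volume] g) (j k : ℤ) :
    inner ℂ (dilTrans j k η) f = (((2 : ℝ) ^ ((j : ℝ) / 2) : ℝ) : ℂ) *
      ∫ y, inner ℂ (η y) (g ((2 : ℝ) ^ j * (y + k))) := by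
  rw [inner_dilTrans_eq_integral]
  congr 1
  apply integral_congr_ae
  filter_upwards [ae_comp_affine hfg (two_zpow_ne_zero j) (-((2 : ℝ) ^ j * k))] with y hy
  rw [sub_neg_eq_add, ← mul_add] at hy
  rw [hy]

theorem sq_two_rpow_half (j : ℤ) : ((2 : ℝ) ^ ((j : ℝ) / 2)) ^ 2 = (2 : ℝ) ^ j := by
  have := sq_two_rpow (-j)
  simpa using this

theorem tendsto_two_zpow_neg : Tendsto (fun n : ℕ => (2 : ℝ) ^ (-(n : ℤ))) atTop (𝓝 0) := by
  have h := tendsto_pow_atTop_nhds_zero_of_lt_one (r := (1 / 2 : ℝ)) (by norm_num) (by norm_num)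
  refine h.congr fun n => ?_
  rw [zpow_neg, zpow_natCast, one_div, inv_pow]

/-- The scale sum is a Riemann sum of mesh `2^{-n}`; substituting `k = ⌊2^n x⌋` makes it an integral
over `x`. -/
theorem scaleSum_neg_eq_integral {η : L2R} (hη : IsSupported η) {f : L2R} {g : ℝ → ℂ}
    (hfg : f =ᵐ[volume] g) (n : ℕ) :
    scaleSum η (-n) f = ∫ x : ℝ,
      ‖∫ y, inner ℂ (η y) (g ((2 : ℝ) ^ (-(n : ℤ)) * (y + ⌊(2 : ℝ) ^ n * x⌋)))‖ ^ 2 := by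
  set G : ℤ → ℝ := fun k => ‖∫ y, inner ℂ (η y) (g ((2 : ℝ) ^ (-(n : ℤ)) * (y + k)))‖ ^ 2 with hG
  have h1 : ∀ k : ℤ, ‖inner ℂ (dilTrans (-n) k η) f‖ ^ 2 = (2 : ℝ) ^ (-(n : ℤ)) * G k := fun k => by
    rw [inner_dilTrans_of_ae_eq η hfg, norm_mul, mul_pow, Complex.norm_real, Real.norm_eq_abs,
      sq_abs, sq_two_rpow_half]
  have hs : Summable G := by
    have h := hη.summable (-n) f
    simp_rw [h1] at h
    exact (summable_mul_left_iff (two_zpow_ne_zero _)).1 h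
  have h2 := Measure.integral_comp_mul_left (fun x : ℝ => G ⌊x⌋) ((2 : ℝ) ^ n)
  rw [integral_comp_floor (fun _ => by positivity) hs] at h2
  unfold scaleSum
  simp_rw [h1]
  rw [tsum_mul_left]
  refine Eq.trans ?_ h2.symm
  rw [abs_of_pos (by positivity), smul_eq_mul, zpow_neg, zpow_natCast]

theorem tendsto_scaleSum_neg_of_continuous {η : L2R} (hη : IsSupported η) {f : L2R} {g : ℝ → ℂ}
    (hg : Continuous g) (hc : HasCompactSupport g) (hfg : f =ᵐ[volume] g) :
    Tendsto (fun n : ℕ => scaleSum η (-n) f) atTop (𝓝 (‖∫ x, η x‖ ^ 2 * ‖f‖ ^ 2)) := by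
  obtain ⟨R, M, hR, hM, hgM, hgR⟩ := exists_bound hg hc
  have hηi := hη.integrable
  have hp : ∀ n : ℕ, (0 : ℝ) < 2 ^ (-(n : ℤ)) := fun n => by positivity
  have hp1 : ∀ n : ℕ, (2 : ℝ) ^ (-(n : ℤ)) ≤ 1 := fun n => by
    rw [zpow_neg, zpow_natCast]
    exact inv_le_one_of_one_le₀ (one_le_pow₀ (by norm_num))
  -- The sampling points converge to `x`, which drives the inner limit and also bounds the support
  -- uniformly in `n`.
  have hdist : ∀ (n : ℕ) (x y : ℝ),
      |(2 : ℝ) ^ (-(n : ℤ)) * (y + ⌊(2 : ℝ) ^ n * x⌋) - x| ≤ 2 ^ (-(n : ℤ)) * (|y| + 1) := by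
    intro n x y
    have e : (2 : ℝ) ^ (-(n : ℤ)) * (y + ⌊(2 : ℝ) ^ n * x⌋) - x =
        2 ^ (-(n : ℤ)) * (y - Int.fract ((2 : ℝ) ^ n * x)) := by
      have h1 : (2 : ℝ) ^ (-(n : ℤ)) * 2 ^ n = 1 := by
        rw [zpow_neg, zpow_natCast, inv_mul_cancel₀ (by positivity)]
      have h2 := Int.self_sub_floor ((2 : ℝ) ^ n * x)
      rw [← h2]
      linear_combination x * h1
    rw [e, abs_mul, abs_of_pos (hp n)]
    refine mul_le_mul_of_nonneg_left ((abs_sub _ _).trans ?_) (hp n).le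
    rw [abs_of_nonneg (Int.fract_nonneg ((2 : ℝ) ^ n * x))]
    have := Int.fract_lt_one ((2 : ℝ) ^ n * x)
    linarith
  have hmeas : ∀ a b : ℝ, AEStronglyMeasurable (fun y => inner ℂ (η y) (g (a * (y + b)))) volume :=
    fun a b => hηi.aestronglyMeasurable.inner
      (hg.comp (by fun_prop : Continuous fun y : ℝ => a * (y + b))).aestronglyMeasurable
  have hbd : ∀ a y : ℝ, ‖inner ℂ (η y) (g a)‖ ≤ M * ‖η y‖ := fun a y => by
    refine (norm_inner_le_norm _ _).trans ?_
    rw [mul_comm]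
    exact mul_le_mul_of_nonneg_right (hgM a) (norm_nonneg _)
  have hlim : ∀ x : ℝ, Tendsto (fun n : ℕ =>
      ∫ y, inner ℂ (η y) (g ((2 : ℝ) ^ (-(n : ℤ)) * (y + ⌊(2 : ℝ) ^ n * x⌋)))) atTop
      (𝓝 (∫ y, inner ℂ (η y) (g x))) := by
    intro x
    refine tendsto_integral_of_dominated_convergence (fun y => M * ‖η y‖) (fun n => hmeas _ _)
      (hηi.norm.const_mul M) (fun n => ae_of_all _ fun y => hbd _ _) (ae_of_all _ fun y => ?_)
    have ht : Tendsto (fun n : ℕ => (2 : ℝ) ^ (-(n : ℤ)) * (y + ⌊(2 : ℝ) ^ n * x⌋)) atTop (𝓝 x) := by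
      rw [tendsto_iff_norm_sub_tendsto_zero]
      refine squeeze_zero (fun _ => norm_nonneg _) (fun n => hdist n x y) ?_
      simpa using tendsto_two_zpow_neg.mul_const (|y| + 1)
    exact ((continuous_const.inner hg).tendsto x).comp ht
  have hval : ∀ x, ‖∫ y, inner ℂ (η y) (g x)‖ ^ 2 = ‖∫ x, η x‖ ^ 2 * ‖g x‖ ^ 2 := fun x => by
    simp only [RCLike.inner_apply]
    rw [integral_const_mul, norm_mul, mul_pow, integral_conj, RCLike.norm_conj, mul_comm]
  have hf : ‖∫ x, η x‖ ^ 2 * ‖f‖ ^ 2 = ∫ x, ‖∫ y, inner ℂ (η y) (g x)‖ ^ 2 := by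
    simp_rw [hval]
    rw [integral_const_mul, norm_sq_eq_integral]
    congr 1
    apply integral_congr_ae
    filter_upwards [hfg] with x hx
    rw [hx]
  rw [hf]
  simp_rw [scaleSum_neg_eq_integral hη hfg]
  -- For `y ∈ [0,3]` the sampling point is within `4` of `x`, so the integrand vanishes once `|x| >
  -- R + 4`.
  refine tendsto_integral_of_dominated_convergence
    ((Set.Icc (-(R + 4)) (R + 4)).indicator fun _ => (M * ∫ y, ‖η y‖) ^ 2) (fun n => ?_)
    ((integrable_indicator_iff measurableSet_Icc).2 continuousOn_const.integrableOn_Icc) (fun n => ae_of_all _ fun x => ?_)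
    (ae_of_all _ fun x => ((hlim x).norm.pow 2))
  · refine Measurable.aestronglyMeasurable ?_
    exact (measurable_of_countable (fun k : ℤ =>
      ‖∫ y, inner ℂ (η y) (g ((2 : ℝ) ^ (-(n : ℤ)) * (y + k)))‖ ^ 2)).comp
      (Int.measurable_floor.comp (measurable_const_mul _))
  · rw [Real.norm_eq_abs, abs_of_nonneg (by positivity)]
    by_cases hx : x ∈ Set.Icc (-(R + 4)) (R + 4)
    · rw [Set.indicator_of_mem hx]
      refine pow_le_pow_left₀ (norm_nonneg _) ?_ 2
      rw [← integral_const_mul]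
      exact norm_integral_le_of_norm_le (hηi.norm.const_mul M) (ae_of_all _ fun y => hbd _ _)
    · rw [Set.indicator_of_notMem hx]
      have hx' : R + 4 < |x| := by
        by_contra h
        exact hx (abs_le.1 (not_lt.1 h))
      have h0 : ∫ y, inner ℂ (η y) (g ((2 : ℝ) ^ (-(n : ℤ)) * (y + ⌊(2 : ℝ) ^ n * x⌋))) = 0 := by
        apply integral_eq_zero_of_ae
        filter_upwards [hη] with y hy
        by_cases hy' : y ∈ Set.Icc (0 : ℝ) 3
        · rw [hgR, inner_zero_right, Pi.zero_apply]
          have h1 := hdist n x y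
          have h2 : (2 : ℝ) ^ (-(n : ℤ)) * (|y| + 1) ≤ 4 := by
            rw [abs_of_nonneg hy'.1]
            have h3 := hp1 n
            have h4 := hp n
            nlinarith [hy'.1, hy'.2]
          have h5 := abs_sub_abs_le_abs_sub x ((2 : ℝ) ^ (-(n : ℤ)) * (y + ⌊(2 : ℝ) ^ n * x⌋))
          rw [abs_sub_comm] at h5
          linarith
        · rw [hy hy', inner_zero_left, Pi.zero_apply]
      rw [h0]
      simp

theorem tendsto_sq_of_tendsto_sqrt {u : ℕ → ℝ} {v : ℝ} (hu : ∀ n, 0 ≤ u n)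
    (h : Tendsto (fun n => √(u n)) atTop (𝓝 v)) : Tendsto u atTop (𝓝 (v ^ 2)) :=
  (h.pow 2).congr fun n => Real.sq_sqrt (hu n)

/-- At fine scales the sums `∑ₖ |⟨η_{j,k}, f⟩|²` recover `|∫ η|² ‖f‖²`. -/
theorem tendsto_scaleSum_neg {η : L2R} (hη : IsSupported η) (f : L2R) :
    Tendsto (fun n : ℕ => scaleSum η (-n) f) atTop (𝓝 (‖∫ x, η x‖ ^ 2 * ‖f‖ ^ 2)) := by
  have h := tendsto_of_lipschitz_of_dense dense_compactlySupported
    (u := fun (n : ℕ) f => √(scaleSum η (-n) f)) (v := fun f => ‖∫ x, η x‖ * ‖f‖)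
    (K := max (√3 * ‖η‖) ‖∫ x, η x‖) (fun n f g => ?_) (fun f g => ?_) ?_ f
  · rw [← mul_pow]
    exact tendsto_sq_of_tendsto_sqrt (fun n => scaleSum_nonneg _ _ _) h
  · exact (lipschitzWith_sqrt_scaleSum hη _ f g).trans
      (mul_le_mul_of_nonneg_right (le_max_left _ _) (norm_nonneg _))
  · rw [← mul_sub, norm_mul, norm_norm]
    exact mul_le_mul (le_max_right _ _) (abs_norm_sub_norm_le f g) (norm_nonneg _) (by positivity)
  · rintro f ⟨g, hg, hc, hfg⟩
    have h := (tendsto_scaleSum_neg_of_continuous hη hg hc hfg).sqrt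
    rwa [← mul_pow, Real.sqrt_sq (by positivity)] at h

/-- Functions dilated towards infinity converge weakly to zero. -/
theorem tendsto_inner_dilTrans_neg (f u : L2R) :
    Tendsto (fun n : ℕ => inner ℂ u (dilTrans (-n) 0 f)) atTop (𝓝 0) := by
  have hneg : ∀ (n : ℕ) (f u : L2R), ‖inner ℂ u (dilTrans (-n) 0 f)‖ ≤ ‖u‖ * ‖f‖ := fun n f u => by
    simpa only [norm_dilTrans] using norm_inner_le_norm (𝕜 := ℂ) u (dilTrans (-n) 0 f)
  -- Density is used twice, first in `f` and then in `u`; for nice `f` and `u` the pairing is at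
  -- most `2^{-n/2} M ‖f‖₁`.
  refine tendsto_of_lipschitz_of_dense dense_compactlySupported
    (u := fun (n : ℕ) f => inner ℂ u (dilTrans (-n) 0 f)) (v := fun _ => 0) (K := ‖u‖)
    (fun n f g => ?_) (fun f g => by simp; positivity) ?_ f
  · rw [← inner_sub_right, ← dilTrans_sub]
    exact hneg n _ _
  rintro f ⟨g, hg, hc, hfg⟩
  refine tendsto_of_lipschitz_of_dense dense_compactlySupported
    (u := fun (n : ℕ) u => inner ℂ u (dilTrans (-n) 0 f)) (v := fun _ => 0) (K := ‖f‖)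
    (fun n u v => ?_) (fun f g => by simp; positivity) ?_ u
  · rw [← inner_sub_left, mul_comm]
    exact hneg n _ _
  rintro u ⟨w, hw, hwc, huw⟩
  obtain ⟨R, M, hR, hM, hwM, hwR⟩ := exists_bound hw hwc
  have hf : Integrable f := (hg.integrable_of_hasCompactSupport hc).congr hfg.symm
  have hb : ∀ n : ℕ, ‖inner ℂ u (dilTrans (-n) 0 f)‖ ≤
      (2 : ℝ) ^ (((-n : ℤ) : ℝ) / 2) * (M * ∫ y, ‖f y‖) := fun n => by
    rw [norm_inner_symm, inner_dilTrans_of_ae_eq f huw, norm_mul, Complex.norm_real,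
      Real.norm_eq_abs, abs_of_pos (by positivity), ← integral_const_mul]
    refine mul_le_mul_of_nonneg_left ?_ (by positivity)
    refine norm_integral_le_of_norm_le (hf.norm.const_mul M) (ae_of_all _ fun y => ?_)
    refine (norm_inner_le_norm _ _).trans ?_
    rw [mul_comm]
    exact mul_le_mul_of_nonneg_right (hwM _) (norm_nonneg _)
  refine squeeze_zero_norm hb ?_
  have h2 : Tendsto (fun n : ℕ => (2 : ℝ) ^ (((-n : ℤ) : ℝ) / 2)) atTop (𝓝 0) := by
    have h := (tendsto_two_zpow_neg).sqrt
    rw [Real.sqrt_zero] at h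
    refine h.congr fun n => ?_
    rw [← sq_two_rpow_half, Real.sqrt_sq (by positivity)]
  simpa using h2.mul_const _

/-- At coarse scales the sums `∑ₖ |⟨η_{j,k}, f⟩|²` vanish. -/
theorem tendsto_scaleSum {η : L2R} (hη : IsSupported η) (f : L2R) :
    Tendsto (fun n : ℕ => scaleSum η n f) atTop (𝓝 0) := by
  have h := tendsto_of_lipschitz_of_dense dense_compactlySupported
    (u := fun (n : ℕ) f => √(scaleSum η n f)) (v := fun _ => 0)
    (K := √3 * ‖η‖) (fun n f g => lipschitzWith_sqrt_scaleSum hη _ f g)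
    (fun f g => by simp; positivity) ?_ f
  · simpa using tendsto_sq_of_tendsto_sqrt (fun n => scaleSum_nonneg _ _ _) h
  rintro f ⟨g, hg, hc, hfg⟩
  obtain ⟨R, M, hR, hM, hgM, hgR⟩ := exists_bound hg hc
  -- If `y ∈ [0,3]` and `k ∉ [-4,1]` then `|y + k| ≥ 1`, so `2^n (y + k)` leaves the support of `g`
  -- once `2^n > R`. A fixed finite number of weakly null terms remains.
  have hfin : ∀ᶠ n : ℕ in atTop, ∑ k ∈ Finset.Icc (-4 : ℤ) 1,
      ‖inner ℂ (dilTrans 0 k η) (dilTrans (-n) 0 f)‖ ^ 2 = scaleSum η n f := by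
    have ht : ∀ᶠ n : ℕ in atTop, R < 2 ^ n :=
      (tendsto_pow_atTop_atTop_of_one_lt (by norm_num : (1 : ℝ) < 2)).eventually_gt_atTop R
    filter_upwards [ht] with n hn
    unfold scaleSum
    simp_rw [← inner_dilTrans_left]
    rw [tsum_eq_sum]
    intro k hk
    rw [inner_dilTrans_of_ae_eq η hfg]
    have h0 : ∫ y, inner ℂ (η y) (g ((2 : ℝ) ^ (n : ℤ) * (y + k))) = 0 := by
      apply integral_eq_zero_of_ae
      filter_upwards [hη] with y hy
      by_cases hy' : y ∈ Set.Icc (0 : ℝ) 3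
      · rw [hgR, inner_zero_right, Pi.zero_apply]
        rw [abs_mul, zpow_natCast, abs_of_pos (by positivity)]
        refine hn.trans_le (le_mul_of_one_le_right (by positivity) ?_)
        rw [Finset.mem_Icc, not_and_or, not_le, not_le] at hk
        rcases hk with hk | hk
        · have : (k : ℝ) ≤ -5 := by exact_mod_cast (by omega : k ≤ -5)
          rw [le_abs]
          right
          linarith [hy'.2]
        · have : (2 : ℝ) ≤ k := by exact_mod_cast (by omega : 2 ≤ k)
          rw [le_abs]
          left
          linarith [hy'.1]
      · rw [hy hy', inner_zero_left, Pi.zero_apply]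
    rw [h0]
    simp
  have hsum : Tendsto (fun n : ℕ => ∑ k ∈ Finset.Icc (-4 : ℤ) 1,
      ‖inner ℂ (dilTrans 0 k η) (dilTrans (-n) 0 f)‖ ^ 2) atTop (𝓝 0) := by
    have h : ∀ k : ℤ, Tendsto (fun n : ℕ =>
        ‖inner ℂ (dilTrans 0 k η) (dilTrans (-n) 0 f)‖ ^ 2) atTop (𝓝 0) := fun k => by
      simpa using ((tendsto_inner_dilTrans_neg f (dilTrans 0 k η)).norm.pow 2)
    simpa using tendsto_finsetSum (Finset.Icc (-4 : ℤ) 1) fun k _ => h k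
  simpa using (hsum.congr' hfin).sqrt

/-! ### The scaling operator and the filter bank. -/

/-- The scaling operator `f ↦ √2 ∑ₖ aₖ f(2x - k)`, whose fixed points solve the scaling
equation. -/
noncomputable def scalingOp (θ : ℝ) (f : L2R) : L2R :=
  ∑ k : Fin 4, (coeff θ k : ℂ) • dilTrans (-1) (k : ℕ) f

/-- Apply the unitary `dilTrans (-1) 0`, inverse to `dilTrans 1 0`. -/
theorem dilTrans_one_eq_iff (θ : ℝ) (f : L2R) :
    dilTrans 1 0 f = ∑ k : Fin 4, (coeff θ k : ℂ) • dilTrans 0 (k : ℕ) f ↔ scalingOp θ f = f := by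
  have h : dilTrans (-1) 0 (∑ k : Fin 4, (coeff θ k : ℂ) • dilTrans 0 (k : ℕ) f) = scalingOp θ f := by
    rw [dilTrans_sum]
    simp only [dilTrans_smul, dilTrans_zero_right_dilTrans]
    rfl
  have h2 : dilTrans (-1) 0 (dilTrans 1 0 f) = f := by
    rw [dilTrans_zero_right_dilTrans]
    exact dilTrans_zero_zero f
  rw [← h]
  constructor
  · intro e
    rw [← e, h2]
  · intro e
    apply (dilTransIsometry (-1) 0).injective
    simp only [dilTransIsometry_apply]
    rw [h2, e]

theorem coeff_sq_add_sq (θ : ℝ) :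
    coeff θ 0 ^ 2 + coeff θ 3 ^ 2 = (1 + Real.sin θ) / 2 ∧
    coeff θ 1 ^ 2 + coeff θ 2 ^ 2 = (1 - Real.sin θ) / 2 ∧
    coeff θ 0 * coeff θ 2 + coeff θ 1 * coeff θ 3 = 0 ∧
    coeff θ 0 * coeff θ 1 - coeff θ 2 * coeff θ 3 = -Real.cos θ / 2 := by
  have h2 : (√2) ^ 2 = 2 := Real.sq_sqrt (by norm_num)
  have hs := Real.sin_sq_add_cos_sq θ
  simp only [coeff, Matrix.cons_val]
  refine ⟨?_, ?_, ?_, ?_⟩ <;> field_simp <;> rw [h2]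
  · linear_combination 2 * hs
  · linear_combination 2 * hs
  · linear_combination -2 * hs
  · ring

/-- Products at lag two cancel by the third identity of `coeff_sq_add_sq`; those of `x 0, x 3` and
of `x 1, x 2` cancel through the alternating signs. The two surviving cross terms have opposite
coefficients, ready to cancel when summed over shifts by two. -/
theorem norm_sq_filter (θ : ℝ) (x : Fin 4 → ℂ) :
    ‖∑ i, (coeff θ i : ℂ) * x i‖ ^ 2 + ‖∑ i : Fin 4, ((-1) ^ (i : ℕ) * (coeff θ i.rev : ℂ)) * x i‖ ^ 2 =
      (1 + Real.sin θ) / 2 * ‖x 0‖ ^ 2 + (1 - Real.sin θ) / 2 * ‖x 1‖ ^ 2 +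
      (1 - Real.sin θ) / 2 * ‖x 2‖ ^ 2 + (1 + Real.sin θ) / 2 * ‖x 3‖ ^ 2 -
      Real.cos θ * (x 0 * (starRingEnd ℂ) (x 1)).re + Real.cos θ * (x 2 * (starRingEnd ℂ) (x 3)).re := by
  obtain ⟨h1, h2, h3, h4⟩ := coeff_sq_add_sq θ
  have e1 : ∑ i : Fin 4, ((-1) ^ (i : ℕ) * (coeff θ i.rev : ℂ)) * x i =
      coeff θ 3 * x 0 - coeff θ 2 * x 1 + coeff θ 1 * x 2 - coeff θ 0 * x 3 := by
    rw [Fin.sum_univ_four]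
    change (-1) ^ 0 * (coeff θ 3 : ℂ) * x 0 + (-1) ^ 1 * (coeff θ 2 : ℂ) * x 1 +
      (-1) ^ 2 * (coeff θ 1 : ℂ) * x 2 + (-1) ^ 3 * (coeff θ 0 : ℂ) * x 3 = _
    ring
  rw [e1, Fin.sum_univ_four]
  simp only [Complex.sq_norm, Complex.normSq_apply, Complex.add_re, Complex.add_im,
    Complex.sub_re, Complex.sub_im, Complex.mul_re, Complex.mul_im, Complex.conj_re,
    Complex.conj_im, Complex.ofReal_re, Complex.ofReal_im]
  linear_combination ((x 0).re ^ 2 + (x 0).im ^ 2 + (x 3).re ^ 2 + (x 3).im ^ 2) * h1 +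
    ((x 1).re ^ 2 + (x 1).im ^ 2 + (x 2).re ^ 2 + (x 2).im ^ 2) * h2 +
    2 * ((x 0).re * (x 2).re + (x 0).im * (x 2).im + (x 1).re * (x 3).re + (x 1).im * (x 3).im) * h3 +
    2 * ((x 0).re * (x 1).re + (x 0).im * (x 1).im - (x 2).re * (x 3).re - (x 2).im * (x 3).im) * h4

theorem hasSum_even_odd {u : ℤ → ℝ} (hu : Summable u) :
    ∃ E O : ℝ, HasSum (fun k => u (2 * k)) E ∧ HasSum (fun k => u (2 * k + 1)) O ∧
      ∑' k, u k = E + O := by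
  have i0 : Function.Injective fun k : ℤ => 2 * k := fun a b h => by simpa using h
  have i1 : Function.Injective fun k : ℤ => 2 * k + 1 := fun a b h => by simpa using h
  have hE : HasSum (fun k => u (2 * k)) (∑' k, u (2 * k)) := (hu.comp_injective i0).hasSum
  have hO : HasSum (fun k => u (2 * k + 1)) (∑' k, u (2 * k + 1)) := (hu.comp_injective i1).hasSum
  refine ⟨_, _, hE, hO, ?_⟩
  have hc : IsCompl (Set.range fun k : ℤ => 2 * k) (Set.range fun k : ℤ => 2 * k + 1) := by
    rw [isCompl_iff, Set.disjoint_iff, codisjoint_iff]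
    constructor
    · rintro _ ⟨⟨a, rfl⟩, ⟨b, hb⟩⟩
      simp only at hb
      omega
    · refine Set.eq_univ_iff_forall.2 ?_
      intro n
      rcases Int.even_or_odd' n with ⟨a, rfl | rfl⟩
      · exact Or.inl ⟨a, rfl⟩
      · exact Or.inr ⟨a, rfl⟩
  exact (HasSum.add_isCompl hc ((Function.Injective.hasSum_range_iff i0).2 hE)
    ((Function.Injective.hasSum_range_iff i1).2 hO)).tsum_eq

theorem hasSum_int_succ {u : ℤ → ℝ} {a : ℝ} (h : HasSum u a) : HasSum (fun k => u (k + 1)) a :=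
  (Equiv.addRight (1 : ℤ)).hasSum_iff.2 h

/-- The analysis filter bank preserves the `ℓ²(ℤ)` norm. -/
theorem hasSum_filter (θ : ℝ) {c : ℤ → ℂ} (hc : Summable fun k => ‖c k‖ ^ 2) :
    HasSum (fun k : ℤ => ‖∑ i : Fin 4, (coeff θ i : ℂ) * c (2 * k + (i : ℕ))‖ ^ 2 +
      ‖∑ i : Fin 4, ((-1) ^ (i : ℕ) * (coeff θ i.rev : ℂ)) * c (2 * k + (i : ℕ))‖ ^ 2)
      (∑' k, ‖c k‖ ^ 2) := by
  obtain ⟨E, O, hE, hO, hEO⟩ := hasSum_even_odd hc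
  have hr : Summable fun k : ℤ => (c (2 * k) * (starRingEnd ℂ) (c (2 * k + 1))).re := by
    refine Summable.of_norm_bounded (hE.summable.add hO.summable) fun k => ?_
    refine (Complex.abs_re_le_norm _).trans ?_
    rw [norm_mul, RCLike.norm_conj]
    nlinarith [sq_nonneg (‖c (2 * k)‖ - ‖c (2 * k + 1)‖), sq_nonneg ‖c (2 * k)‖,
      sq_nonneg ‖c (2 * k + 1)‖]
  have hR := hr.hasSum
  -- The terms in `x 2, x 3` are those in `x 0, x 1` with `k` replaced by `k + 1`: after summation
  -- the weights `(1 ± sin θ)/2` add to one and the cross terms cancel.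
  have h := (((((hE.mul_left ((1 + Real.sin θ) / 2)).add (hO.mul_left ((1 - Real.sin θ) / 2))).add
    ((hasSum_int_succ hE).mul_left ((1 - Real.sin θ) / 2))).add
    ((hasSum_int_succ hO).mul_left ((1 + Real.sin θ) / 2))).add (hR.mul_left (-Real.cos θ))).add
    ((hasSum_int_succ hR).mul_left (Real.cos θ))
  refine (congrArg₂ (HasSum · ·) (funext fun k => ?_) ?_).mpr h
  · have e3 : 2 * k + 3 = 2 * (k + 1) + 1 := by ring
    have e2 : 2 * k + 2 = 2 * (k + 1) := by ring
    rw [norm_sq_filter θ fun i : Fin 4 => c (2 * k + (i : ℕ))]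
    simp [e3, e2, sub_eq_add_neg]
  · rw [hEO]
    ring

theorem inner_dilTrans_scalingOp (θ : ℝ) (η f : L2R) (j k : ℤ) :
    inner ℂ (dilTrans j k (scalingOp θ η)) f =
      ∑ i : Fin 4, (coeff θ i : ℂ) * inner ℂ (dilTrans (j - 1) (2 * k + (i : ℕ)) η) f := by
  unfold scalingOp
  rw [dilTrans_sum, sum_inner]
  refine Finset.sum_congr rfl fun i _ => ?_
  rw [dilTrans_smul, inner_smul_left, dilTrans_dilTrans_neg_one, Complex.conj_ofReal]

theorem inner_dilTrans_mother (θ : ℝ) (η f : L2R) (j k : ℤ) :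
    inner ℂ (dilTrans j k (mother θ η)) f =
      ∑ i : Fin 4, ((-1) ^ (i : ℕ) * (coeff θ i.rev : ℂ)) *
        inner ℂ (dilTrans (j - 1) (2 * k + (i : ℕ)) η) f := by
  unfold mother
  rw [dilTrans_sum, sum_inner]
  refine Finset.sum_congr rfl fun i _ => ?_
  rw [dilTrans_smul, inner_smul_left, dilTrans_dilTrans_neg_one, map_mul, Complex.conj_ofReal]
  simp

/-! ### Telescoping over scales. -/

section FixedPoint

variable {θ : ℝ} {η : L2R}

/-- Since `η` is fixed by `scalingOp θ`, the low-pass channel reproduces the coefficients at scale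
`j`; the high-pass channel is what remains. -/
theorem hasSum_mother (hη : IsSupported η) (hr : scalingOp θ η = η) (j : ℤ) (f : L2R) :
    HasSum (fun k => ‖inner ℂ (dilTrans j k (mother θ η)) f‖ ^ 2)
      (scaleSum η (j - 1) f - scaleSum η j f) := by
  have h := hasSum_filter θ (hη.summable (j - 1) f)
  simp_rw [← inner_dilTrans_mother, ← inner_dilTrans_scalingOp, hr] at h
  have h2 := h.sub (hη.summable j f).hasSum
  simp only [add_sub_cancel_left] at h2
  exact h2

theorem scaleSum_antitone (hη : IsSupported η) (hr : scalingOp θ η = η) (f : L2R) :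
    Antitone fun j => scaleSum η j f := by
  have h : Monotone fun j => scaleSum η (-j) f := by
    refine monotone_int_of_le_succ fun j => ?_
    have := hasSum_le (fun k => by positivity) hasSum_zero (hasSum_mother hη hr (-j) f)
    rw [show -(j + 1) = -j - 1 by ring]
    linarith
  intro i j hij
  simpa using h (neg_le_neg hij)

/-- The scale sums increase towards fine scales, so each is bounded by its fine-scale limit. -/
theorem scaleSum_le_of_scalingOp (hη : IsSupported η) (hr : scalingOp θ η = η) (j : ℤ) (f : L2R) :
    scaleSum η j f ≤ ‖∫ x, η x‖ ^ 2 * ‖f‖ ^ 2 := by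
  refine ge_of_tendsto (tendsto_scaleSum_neg hη f) ?_
  filter_upwards [eventually_ge_atTop j.natAbs] with n hn
  exact scaleSum_antitone hη hr f (by omega)

/-- A supported solution of the scaling equation with vanishing integral is zero. -/
theorem eq_zero_of_scalingOp (hη : IsSupported η) (hr : scalingOp θ η = η) (h0 : ∫ x, η x = 0) :
    η = 0 := by
  have h := scaleSum_le_of_scalingOp hη hr 0 η
  rw [h0] at h
  have h1 := (hη.summable 0 η).le_tsum 0 fun _ _ => by positivity
  rw [dilTrans_zero_zero] at h1
  have h2 : ‖inner ℂ η η‖ ^ 2 ≤ 0 := h1.trans (h.trans (by simp))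
  simpa using h2

/-- Summing over all scales: the squared wavelet coefficients add up to `|∫ η|² ‖f‖²`. -/
theorem hasSum_mother_all (hη : IsSupported η) (hr : scalingOp θ η = η) (f : L2R) :
    HasSum (fun p : ℤ × ℤ => ‖inner ℂ (dilTrans p.1 p.2 (mother θ η)) f‖ ^ 2)
      (‖∫ x, η x‖ ^ 2 * ‖f‖ ^ 2) := by
  have hj := fun j => hasSum_mother hη hr j f
  -- Scales `j ≥ 1` telescope to `scaleSum η 0 f`, scales `j ≤ 0` to the fine-scale limit minus that
  -- value.
  have hpos : HasSum (fun n : ℕ => scaleSum η ((n + 1 : ℕ) - 1) f - scaleSum η (n + 1 : ℕ) f)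
      (scaleSum η 0 f) := by
    rw [hasSum_iff_tendsto_nat_of_nonneg fun n => by
      have := scaleSum_antitone hη hr f (show ((n + 1 : ℕ) : ℤ) - 1 ≤ (n + 1 : ℕ) by omega)
      simp only at this
      linarith]
    have e : ∀ n : ℕ, ∑ i ∈ Finset.range n,
        (scaleSum η ((i + 1 : ℕ) - 1) f - scaleSum η (i + 1 : ℕ) f) =
        scaleSum η 0 f - scaleSum η n f := fun n => by
      simpa using Finset.sum_range_sub' (fun i : ℕ => scaleSum η i f) n
    simp_rw [e]
    simpa using tendsto_const_nhds.sub (tendsto_scaleSum hη f)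
  have hneg : HasSum (fun n : ℕ => scaleSum η (-n - 1) f - scaleSum η (-n) f)
      (‖∫ x, η x‖ ^ 2 * ‖f‖ ^ 2 - scaleSum η 0 f) := by
    rw [hasSum_iff_tendsto_nat_of_nonneg fun n => by
      have := scaleSum_antitone hη hr f (show -(n : ℤ) - 1 ≤ -n by omega)
      simp only at this
      linarith]
    have e : ∀ n : ℕ, ∑ i ∈ Finset.range n,
        (scaleSum η (-i - 1) f - scaleSum η (-i) f) =
        scaleSum η (-n) f - scaleSum η 0 f := fun n => by
      have h := Finset.sum_range_sub (fun i : ℕ => scaleSum η (-i) f) n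
      simp only [Nat.cast_add, Nat.cast_one, neg_add, ← sub_eq_add_neg] at h
      simpa using h
    simp_rw [e]
    exact (tendsto_scaleSum_neg hη f).sub_const _
  have hall : HasSum (fun j : ℤ => scaleSum η (j - 1) f - scaleSum η j f)
      (‖∫ x, η x‖ ^ 2 * ‖f‖ ^ 2) := by
    have h := HasSum.of_nat_of_neg_add_one (f := fun j : ℤ => scaleSum η (-j - 1) f - scaleSum η (-j) f)
      hneg (by
        refine hpos.congr_fun fun n => ?_
        push_cast
        congr 2)
    rw [sub_add_cancel] at h
    simpa [Function.comp_def] using (Equiv.neg ℤ).hasSum_iff.2 h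
  have hs : Summable (fun p : ℤ × ℤ => ‖inner ℂ (dilTrans p.1 p.2 (mother θ η)) f‖ ^ 2) := by
    rw [summable_prod_of_nonneg fun _ => by positivity]
    refine ⟨fun j => (hj j).summable, ?_⟩
    simp_rw [fun j => (hj j).tsum_eq]
    exact hall.summable
  have h := hs.hasSum.prod_fiberwise hj
  rw [hall.unique h]
  exact hs.hasSum

end FixedPoint

/-! ### Existence of a scaling function. -/

theorem IsSupported.add {f g : L2R} (hf : IsSupported f) (hg : IsSupported g) :
    IsSupported (f + g) := by
  filter_upwards [hf, hg, Lp.coeFn_add f g] with x h1 h2 h3 hx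
  rw [h3, Pi.add_apply, h1 hx, h2 hx, add_zero]

theorem IsSupported.smul {f : L2R} (hf : IsSupported f) (c : ℂ) : IsSupported (c • f) := by
  filter_upwards [hf, Lp.coeFn_smul c f] with x h1 h2 hx
  rw [h2, Pi.smul_apply, h1 hx, smul_zero]

theorem isSupported_zero : IsSupported 0 := by
  filter_upwards [Lp.coeFn_zero ℂ 2 (volume : Measure ℝ)] with x h1 _
  rw [h1, Pi.zero_apply]

theorem IsSupported.sum {ι : Type*} {s : Finset ι} {f : ι → L2R} (hf : ∀ i, IsSupported (f i)) :
    IsSupported (∑ i ∈ s, f i) :=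
  Finset.sum_induction f IsSupported (fun _ _ => IsSupported.add) isSupported_zero fun i _ => hf i

theorem IsSupported.sub {f g : L2R} (hf : IsSupported f) (hg : IsSupported g) :
    IsSupported (f - g) := by
  simpa [sub_eq_add_neg] using hf.add (hg.smul (-1))

theorem IsSupported.dilTrans_neg_one {f : L2R} (hf : IsSupported f) (k : Fin 4) :
    IsSupported (dilTrans (-1) (k : ℕ) f) := by
  filter_upwards [coeFn_dilTrans (-1) (k : ℕ) f,
    ae_comp_affine hf (two_zpow_ne_zero (- -1)) (((k : ℕ) : ℤ) : ℝ)] with x h1 h2 hx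
  rw [h1, h2, mul_zero]
  intro h
  apply hx
  have h3 : ((k : ℕ) : ℝ) ≤ 3 := by
    have := k.is_le
    exact_mod_cast this
  have h4 : (0 : ℝ) ≤ ((k : ℕ) : ℝ) := Nat.cast_nonneg _
  norm_num at h ⊢
  constructor <;> linarith [h.1, h.2]

theorem IsSupported.map_scalingOp {f : L2R} (hf : IsSupported f) (θ : ℝ) :
    IsSupported (scalingOp θ f) :=
  IsSupported.sum fun k => (hf.dilTrans_neg_one k).smul _

theorem inner_self_eq_ofReal (f : L2R) : inner ℂ f f = ((‖f‖ ^ 2 : ℝ) : ℂ) := by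
  rw [inner_self_eq_norm_sq_to_K]
  push_cast
  rfl

/-- The indicator function of a bounded interval `(a, b]` as an element of `L²(ℝ)`. -/
noncomputable def box (a b : ℝ) : L2R :=
  indicatorConstLp 2 (measurableSet_Ioc (a := a) (b := b)) (by simp) 1

theorem coeFn_box (a b : ℝ) : box a b =ᵐ[volume] (Set.Ioc a b).indicator fun _ => 1 :=
  indicatorConstLp_coeFn

theorem inner_box (a b : ℝ) (f : L2R) : inner ℂ (box a b) f = ∫ x in Set.Ioc a b, f x :=
  L2.inner_indicatorConstLp_one _ _ _

theorem isSupported_box {b : ℝ} (hb : b ≤ 3) : IsSupported (box 0 b) := by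
  filter_upwards [coeFn_box 0 b] with x hx hx'
  rw [hx, Set.indicator_of_notMem]
  exact fun h => hx' ⟨h.1.le, h.2.trans hb⟩

theorem integral_box {b : ℝ} (hb : 0 ≤ b) : ∫ x, box 0 b x = b := by
  rw [integral_congr_ae (coeFn_box 0 b), integral_indicator measurableSet_Ioc]
  simp [hb]

theorem norm_sq_box {b : ℝ} (hb : 0 ≤ b) : ‖box 0 b‖ ^ 2 = b := by
  rw [norm_sq_eq_integral]
  have h : ∀ᵐ x : ℝ, ‖box 0 b x‖ ^ 2 = (Set.Ioc 0 b).indicator (fun _ => 1) x := by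
    filter_upwards [coeFn_box 0 b] with x hx
    rw [hx]
    by_cases h : x ∈ Set.Ioc 0 b <;> simp [h]
  rw [integral_congr_ae h, integral_indicator measurableSet_Ioc]
  simp [hb]

/-- Makes the integral weakly continuous on supported functions. -/
theorem IsSupported.integral_eq_inner {f : L2R} (hf : IsSupported f) :
    ∫ x, f x = inner ℂ (box 0 3) f := by
  rw [inner_box, ← integral_indicator measurableSet_Ioc]
  apply integral_congr_ae
  have h0 := hf.dilTrans_zero 0
  rw [dilTrans_zero_zero] at h0
  filter_upwards [h0] with x hx
  by_cases h : x ∈ Set.Ioc (0 : ℝ) 3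
  · simp [h]
  · rw [Set.indicator_of_notMem h]
    apply hx
    simpa using h

theorem coeff_sum (θ : ℝ) : ∑ k, coeff θ k = √2 := by
  have h2 : √2 * √2 = 2 := Real.mul_self_sqrt (by norm_num)
  rw [Fin.sum_univ_four]
  simp only [coeff, Matrix.cons_val]
  field_simp
  linarith

/-- Each dilate contributes a factor `1/√2`, and the coefficients sum to `√2`. -/
theorem IsSupported.integral_scalingOp {f : L2R} (hf : IsSupported f) (θ : ℝ) :
    ∫ x, scalingOp θ f x = ∫ x, f x := by
  rw [(hf.map_scalingOp θ).integral_eq_inner, scalingOp, inner_sum]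
  simp_rw [inner_smul_right, ← (hf.dilTrans_neg_one _).integral_eq_inner, integral_dilTrans_neg_one]
  rw [← Finset.sum_mul, ← Complex.ofReal_sum, coeff_sum, ← mul_assoc, mul_inv_cancel₀, one_mul]
  simp

/-- Correlations of finite combinations of the translates of `f(2x)`. -/
theorem inner_sum_dilTrans (u v : Fin 4 → ℂ) (f : L2R) (k : ℤ) :
    inner ℂ (∑ i : Fin 4, u i • dilTrans (-1) (i : ℕ) f)
      (dilTrans 0 k (∑ i : Fin 4, v i • dilTrans (-1) (i : ℕ) f)) =
    ∑ i : Fin 4, ∑ j : Fin 4, (starRingEnd ℂ) (u i) * v j *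
      inner ℂ f (dilTrans 0 (2 * k + (j : ℕ) - (i : ℕ)) f) := by
  rw [dilTrans_sum, sum_inner]
  refine Finset.sum_congr rfl fun i _ => ?_
  rw [inner_sum]
  refine Finset.sum_congr rfl fun j _ => ?_
  rw [dilTrans_smul, inner_smul_left, inner_smul_right, dilTrans_dilTrans_neg_one, zero_sub,
    inner_dilTrans_dilTrans]
  ring

theorem inner_scalingOp (θ : ℝ) (f : L2R) (k : ℤ) :
    inner ℂ (scalingOp θ f) (dilTrans 0 k (scalingOp θ f)) =
    ∑ i : Fin 4, ∑ j : Fin 4, (coeff θ i : ℂ) * coeff θ j *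
      inner ℂ f (dilTrans 0 (2 * k + (j : ℕ) - (i : ℕ)) f) := by
  refine (inner_sum_dilTrans _ _ f k).trans ?_
  simp only [Complex.conj_ofReal]

theorem sum_coeff_sq (θ : ℝ) :
    coeff θ 0 ^ 2 + coeff θ 1 ^ 2 + coeff θ 2 ^ 2 + coeff θ 3 ^ 2 = 1 := by
  obtain ⟨h1, h2, -, -⟩ := coeff_sq_add_sq θ
  linear_combination h1 + h2

/-- The scaling operator preserves orthonormality of the integer translates. -/
theorem inner_scalingOp_of_orthonormal (θ : ℝ) {f : L2R}
    (hf : ∀ k : ℤ, inner ℂ f (dilTrans 0 k f) = if k = 0 then 1 else 0) (k : ℤ) :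
    inner ℂ (scalingOp θ f) (dilTrans 0 k (scalingOp θ f)) = if k = 0 then 1 else 0 := by
  have h1 : (coeff θ 0 : ℂ) ^ 2 + (coeff θ 1 : ℂ) ^ 2 + (coeff θ 2 : ℂ) ^ 2 + (coeff θ 3 : ℂ) ^ 2 = 1 := by
    exact_mod_cast sum_coeff_sq θ
  have h2 : (coeff θ 0 : ℂ) * coeff θ 2 + coeff θ 1 * coeff θ 3 = 0 := by
    exact_mod_cast (coeff_sq_add_sq θ).2.2.1
  rw [inner_scalingOp]
  simp_rw [hf]
  -- As `|j - i| ≤ 3`, the lag `2k + j - i` can vanish only for `|k| ≤ 1`.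
  by_cases hk : k ≠ 0 ∧ k ≠ 1 ∧ k ≠ -1
  · rw [if_neg hk.1]
    refine Finset.sum_eq_zero fun i _ => Finset.sum_eq_zero fun j _ => ?_
    have hi := i.is_le
    have hj := j.is_le
    rw [if_neg (by omega), mul_zero]
  have v3 : ((3 : Fin 4) : ℕ) = 3 := rfl
  simp only [Fin.sum_univ_four, Fin.val_zero, Fin.val_one, Fin.val_two, v3, Nat.cast_zero,
    Nat.cast_one, Nat.cast_ofNat]
  obtain rfl | rfl | rfl : k = 0 ∨ k = 1 ∨ k = -1 := by tauto
  · norm_num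
    linear_combination h1
  · norm_num
    linear_combination h2
  · norm_num
    linear_combination h2

theorem inner_box_dilTrans (k : ℤ) :
    inner ℂ (box 0 1) (dilTrans 0 k (box 0 1)) = if k = 0 then 1 else 0 := by
  by_cases hk : k = 0
  · rw [if_pos hk, hk, dilTrans_zero_zero, inner_self_eq_ofReal, norm_sq_box zero_le_one,
      Complex.ofReal_one]
  rw [if_neg hk, L2.inner_def]
  apply integral_eq_zero_of_ae
  filter_upwards [coeFn_box 0 1, coeFn_dilTrans 0 k (box 0 1),
    ae_comp_affine (coeFn_box 0 1) (two_zpow_ne_zero (-0)) k] with x h1 h2 h3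
  rw [h1, h2, h3, Pi.zero_apply]
  by_cases hx : x ∈ Set.Ioc (0 : ℝ) 1
  · rw [Set.indicator_of_notMem (a := (2 : ℝ) ^ (-0 : ℤ) * x - k), mul_zero, inner_zero_right]
    simp only [neg_zero, zpow_zero, one_mul, Set.mem_Ioc, not_and_or, not_lt, not_le]
    rcases lt_or_gt_of_ne hk with h | h
    · right
      have : (k : ℝ) ≤ -1 := by exact_mod_cast (by omega : k ≤ -1)
      linarith [hx.1]
    · left
      have : (1 : ℝ) ≤ k := by exact_mod_cast (by omega : 1 ≤ k)
      linarith [hx.2]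
  · rw [Set.indicator_of_notMem hx, inner_zero_left]

/-- Bounded sequences in a Hilbert space have weak limits along a nonprincipal ultrafilter. -/
theorem exists_weak_limit {H : Type*} [NormedAddCommGroup H] [InnerProductSpace ℂ H]
    [CompleteSpace H] {u : ℕ → H} {C : ℝ} (hu : ∀ n, ‖u n‖ ≤ C) :
    ∃ x : H, ∀ g, Tendsto (fun n => inner ℂ (u n) g) (hyperfilter ℕ) (𝓝 (inner ℂ x g)) := by
  let F : ℕ → WeakDual ℂ H := fun n => StrongDual.toWeakDual (InnerProductSpace.toDual ℂ H (u n))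
  have hF : ∀ n, F n ∈ WeakDual.toStrongDual ⁻¹' Metric.closedBall (0 : StrongDual ℂ H) C := fun n => by
    rw [Set.mem_preimage, mem_closedBall_zero_iff]
    exact ((InnerProductSpace.toDual ℂ H).norm_map (u n)).trans_le (hu n)
  obtain ⟨y, -, hy⟩ := (WeakDual.isCompact_closedBall (0 : StrongDual ℂ H) C).ultrafilter_le_nhds
    ((hyperfilter ℕ).map F) (by
      rw [Ultrafilter.coe_map, le_principal_iff]
      exact Filter.mem_map.2 (Filter.univ_mem' hF))
  refine ⟨(InnerProductSpace.toDual ℂ H).symm (WeakDual.toStrongDual y), fun g => ?_⟩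
  rw [InnerProductSpace.toDual_symm_apply]
  have ht : Tendsto F (hyperfilter ℕ) (𝓝 y) := hy
  exact ((WeakDual.eval_continuous g).tendsto y).comp ht

/-- The scaling operator as a continuous linear map. -/
noncomputable def scalingCLM (θ : ℝ) : L2R →L[ℂ] L2R :=
  ∑ k : Fin 4, (coeff θ k : ℂ) • (dilTransIsometry (-1) (k : ℕ)).toContinuousLinearMap

theorem scalingCLM_apply (θ : ℝ) (f : L2R) : scalingCLM θ f = scalingOp θ f := by
  simp only [scalingCLM, sum_apply]
  rfl

/-- Test against the part of `φ` off `[0,3]`: the pairings with `u n` vanish, and their limit is the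
squared norm of that part. -/
theorem isSupported_of_tendsto {l : Filter ℕ} [l.NeBot] {u : ℕ → L2R} {φ : L2R}
    (hu : ∀ n, IsSupported (u n))
    (h : ∀ g, Tendsto (fun n => inner ℂ (u n) g) l (𝓝 (inner ℂ φ g))) : IsSupported φ := by
  have hs : MeasurableSet (Set.Icc (0 : ℝ) 3)ᶜ := measurableSet_Icc.compl
  have h0 : ∀ n, inner ℂ (u n) (restrictTo hs φ) = 0 := fun n => by
    rw [L2.inner_def]
    apply integral_eq_zero_of_ae
    filter_upwards [hu n, coeFn_restrictTo hs φ] with x h1 h2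
    by_cases hx : x ∈ Set.Icc (0 : ℝ) 3
    · rw [h2, Set.indicator_of_notMem (by simpa using hx), inner_zero_right, Pi.zero_apply]
    · rw [h1 hx, inner_zero_left, Pi.zero_apply]
  have h1 := h (restrictTo hs φ)
  simp_rw [h0] at h1
  have h2 : inner ℂ φ (restrictTo hs φ) = 0 := (tendsto_nhds_unique h1 tendsto_const_nhds)
  have h3 : inner ℂ φ (restrictTo hs φ) = inner ℂ (restrictTo hs φ) (restrictTo hs φ) := by
    rw [L2.inner_def, L2.inner_def]
    apply integral_congr_ae
    filter_upwards [coeFn_restrictTo hs φ] with x h2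
    rw [h2]
    by_cases hx : x ∈ Set.Icc (0 : ℝ) 3 <;> simp [hx]
  rw [h3, inner_self_eq_zero] at h2
  have h4 := coeFn_restrictTo hs φ
  rw [h2] at h4
  filter_upwards [h4, Lp.coeFn_zero ℂ 2 (volume : Measure ℝ)] with x h5 h6 hx
  rw [h6, Set.indicator_of_mem (by simpa using hx)] at h5
  exact h5.symm

/-- The cascade iterates keep orthonormal translates, hence norm one. For their averages `u n`, `T
(u n) - u n` telescopes to `(c (n+1) - c 0)/(n+1)`, so a weak limit is a fixed point without any
convergence of the iterates themselves. -/
theorem exists_fixedPoint (θ : ℝ) :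
    ∃ φ : L2R, IsSupported φ ∧ scalingOp θ φ = φ ∧ ∫ x, φ x = 1 := by
  set T := scalingCLM θ with hT
  let c : ℕ → L2R := fun n => (scalingOp θ)^[n] (box 0 1)
  have hc1 : ∀ n, c (n + 1) = scalingOp θ (c n) := fun n => Function.iterate_succ_apply' _ _ _
  have hcs : ∀ n, IsSupported (c n) := fun n => by
    induction n with
    | zero => exact isSupported_box (by norm_num)
    | succ n ih => rw [hc1]; exact ih.map_scalingOp θ
  have hci : ∀ n, ∫ x, c n x = 1 := fun n => by
    induction n with
    | zero => exact (integral_box zero_le_one).trans (by simp)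
    | succ n ih => rw [hc1, (hcs n).integral_scalingOp, ih]
  have hco : ∀ n, ∀ k : ℤ, inner ℂ (c n) (dilTrans 0 k (c n)) = if k = 0 then 1 else 0 := fun n => by
    induction n with
    | zero => exact inner_box_dilTrans
    | succ n ih => rw [hc1]; exact inner_scalingOp_of_orthonormal θ ih
  have hcn : ∀ n, ‖c n‖ = 1 := fun n => by
    have h := hco n 0
    rw [dilTrans_zero_zero, if_pos rfl, inner_self_eq_ofReal] at h
    have h2 : ‖c n‖ ^ 2 = 1 := by exact_mod_cast h
    exact (pow_eq_one_iff_of_nonneg (norm_nonneg _) two_ne_zero).1 h2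
  let u : ℕ → L2R := fun n => ((n + 1 : ℂ)⁻¹) • ∑ i ∈ Finset.range (n + 1), c i
  have hn1 : ∀ n : ℕ, ‖((n : ℂ) + 1)⁻¹‖ = ((n : ℝ) + 1)⁻¹ := fun n => by
    rw [norm_inv]
    congr 1
    exact_mod_cast Complex.norm_natCast (n + 1)
  have hus : ∀ n, IsSupported (u n) := fun n => IsSupported.smul (IsSupported.sum hcs) _
  have hun : ∀ n, ‖u n‖ ≤ 1 := fun n => by
    refine (norm_smul_le _ _).trans ?_
    rw [hn1, inv_mul_le_one₀ (by positivity)]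
    refine (norm_sum_le _ _).trans ?_
    simp [hcn]
  have hui : ∀ n, inner ℂ (box 0 3) (u n) = 1 := fun n => by
    rw [inner_smul_right, inner_sum]
    simp_rw [← (hcs _).integral_eq_inner, hci]
    have : (n : ℂ) + 1 ≠ 0 := by exact_mod_cast n.succ_ne_zero
    simp [this]
  have huT : ∀ n, T (u n) - u n = ((n : ℂ) + 1)⁻¹ • (c (n + 1) - c 0) := fun n => by
    have : T (u n) = ((n + 1 : ℂ)⁻¹) • ∑ i ∈ Finset.range (n + 1), c (i + 1) := by
      simp only [u, map_smul, map_sum, hc1, hT, scalingCLM_apply]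
    rw [this, ← Finset.sum_range_sub, Finset.sum_sub_distrib, smul_sub]
  have huT0 : Tendsto (fun n => T (u n) - u n) atTop (𝓝 0) := by
    refine squeeze_zero_norm (a := fun n : ℕ => ((n : ℝ) + 1)⁻¹ * 2) (fun n => ?_) ?_
    · rw [huT]
      refine (norm_smul_le _ _).trans ?_
      rw [hn1]
      refine mul_le_mul_of_nonneg_left ((norm_sub_le _ _).trans ?_) (by positivity)
      rw [hcn, hcn]
      norm_num
    · simpa using (tendsto_one_div_add_atTop_nhds_zero_nat (𝕜 := ℝ)).mul_const 2
  obtain ⟨φ, hφ⟩ := exists_weak_limit hun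
  have hφs := isSupported_of_tendsto hus hφ
  have hle : (hyperfilter ℕ : Filter ℕ) ≤ atTop := Nat.hyperfilter_le_atTop
  refine ⟨φ, hφs, ?_, ?_⟩
  · rw [← scalingCLM_apply, ← hT]
    refine ext_inner_right ℂ fun g => ?_
    have h1 := hφ (ContinuousLinearMap.adjoint T g)
    simp_rw [ContinuousLinearMap.adjoint_inner_right] at h1
    have h2 : Tendsto (fun n => inner ℂ (T (u n) - u n) g) (hyperfilter ℕ) (𝓝 0) := by
      have := (huT0.mono_left hle).inner (tendsto_const_nhds (x := g)) (𝕜 := ℂ)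
      rwa [inner_zero_left] at this
    have h3 := h2.add (hφ g)
    simp_rw [← inner_add_left, sub_add_cancel, zero_add] at h3
    exact tendsto_nhds_unique h1 h3
  · rw [hφs.integral_eq_inner, ← inner_conj_symm]
    have h1 := hφ (box 0 3)
    have h2 : ∀ n, inner ℂ (u n) (box 0 3) = 1 := fun n => by
      rw [← inner_conj_symm, hui, map_one]
    simp_rw [h2] at h1
    rw [tendsto_nhds_unique h1 tendsto_const_nhds, map_one]

theorem isScalingFunction_iff (θ : ℝ) (φ : L2R) :
    IsScalingFunction θ φ ↔ IsSupported φ ∧ scalingOp θ φ = φ ∧ ∫ x, φ x = 1 :=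
  ⟨fun h => ⟨h.supported, (dilTrans_one_eq_iff θ φ).1 h.scaling, h.normalized⟩,
    fun h => ⟨h.1, (dilTrans_one_eq_iff θ φ).2 h.2.1, h.2.2⟩⟩

/-! ### Correlations of the translates and the norm of the scaling function. -/

theorem inner_dilTrans_neg (f : L2R) (k : ℤ) :
    inner ℂ f (dilTrans 0 (-k) f) = (starRingEnd ℂ) (inner ℂ f (dilTrans 0 k f)) := by
  rw [inner_conj_symm]
  nth_rw 4 [← dilTrans_zero_zero f]
  rw [inner_dilTrans_dilTrans, zero_sub]

theorem IsSupported.inner_dilTrans_eq_zero {f : L2R} (hf : IsSupported f) {k : ℤ} (hk : 3 ≤ |k|) :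
    inner ℂ f (dilTrans 0 k f) = 0 := by
  rw [L2.inner_def]
  apply integral_eq_zero_of_ae
  have h0 := hf.dilTrans_zero 0
  rw [dilTrans_zero_zero] at h0
  filter_upwards [h0, hf.dilTrans_zero k] with x h1 h2
  rw [Pi.zero_apply]
  by_cases hx : x ∈ Set.Ioc (k : ℝ) (k + 3)
  · rw [h1, inner_zero_left]
    rintro ⟨h3, h4⟩
    norm_num at h3 h4
    rcases le_abs.1 hk with h | h
    · have : (3 : ℝ) ≤ k := by exact_mod_cast h
      linarith [hx.1]
    · have : (k : ℝ) ≤ -3 := by exact_mod_cast (by omega : k ≤ -3)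
      linarith [hx.2]
  · rw [h2 hx, inner_zero_right]

section FixedPoint

variable {θ : ℝ} {φ : L2R}

theorem sum_coeff_products (θ : ℝ) :
    coeff θ 0 * coeff θ 3 = Real.sin θ * (1 + Real.sin θ) / 4 ∧
    coeff θ 0 * coeff θ 1 + coeff θ 1 * coeff θ 2 + coeff θ 2 * coeff θ 3 =
      1 / 2 - Real.sin θ * (1 + Real.sin θ) / 4 := by
  have h2 : (√2) ^ 2 = 2 := Real.sq_sqrt (by norm_num)
  have hs := Real.sin_sq_add_cos_sq θ
  simp only [coeff, Matrix.cons_val]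
  constructor <;> field_simp <;> rw [h2]
  · linear_combination -4 * hs
  · linear_combination 4 * hs

/-- The scaling equation for the correlations at lags one and two. -/
theorem correlation_eqs (hs : IsSupported φ) (hT : scalingOp θ φ = φ) :
    inner ℂ φ (dilTrans 0 2 φ) =
      ((coeff θ 0 * coeff θ 3 : ℝ) : ℂ) * inner ℂ φ (dilTrans 0 1 φ) ∧
    inner ℂ φ (dilTrans 0 1 φ) = inner ℂ φ (dilTrans 0 2 φ) +
      ((coeff θ 0 * coeff θ 1 + coeff θ 1 * coeff θ 2 + coeff θ 2 * coeff θ 3 : ℝ) : ℂ) *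
        inner ℂ φ (dilTrans 0 1 φ) +
      ((coeff θ 0 * coeff θ 3 : ℝ) : ℂ) * (starRingEnd ℂ) (inner ℂ φ (dilTrans 0 1 φ)) ∧
    ((coeff θ 0 * coeff θ 1 + coeff θ 1 * coeff θ 2 + coeff θ 2 * coeff θ 3 : ℝ) : ℂ) *
      (inner ℂ φ (dilTrans 0 1 φ) + (starRingEnd ℂ) (inner ℂ φ (dilTrans 0 1 φ))) = 0 := by
  have h1 : (coeff θ 0 : ℂ) ^ 2 + (coeff θ 1 : ℂ) ^ 2 + (coeff θ 2 : ℂ) ^ 2 + (coeff θ 3 : ℂ) ^ 2 = 1 := by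
    exact_mod_cast sum_coeff_sq θ
  have h2 : (coeff θ 0 : ℂ) * coeff θ 2 + coeff θ 1 * coeff θ 3 = 0 := by
    exact_mod_cast (coeff_sq_add_sq θ).2.2.1
  have e := inner_scalingOp θ φ
  simp_rw [hT] at e
  have v3 : ((3 : Fin 4) : ℕ) = 3 := rfl
  simp only [Fin.sum_univ_four, Fin.val_zero, Fin.val_one, Fin.val_two, v3, Nat.cast_zero,
    Nat.cast_one, Nat.cast_ofNat] at e
  have z : ∀ k : ℤ, 3 ≤ |k| → inner ℂ φ (dilTrans 0 k φ) = 0 :=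
    fun k hk => hs.inner_dilTrans_eq_zero hk
  have n1 := inner_dilTrans_neg φ 1
  have n2 := inner_dilTrans_neg φ 2
  have z3 := z 3 (by norm_num)
  have z4 := z 4 (by norm_num)
  have z5 := z 5 (by norm_num)
  have z6 := z 6 (by norm_num)
  have z7 := z 7 (by norm_num)
  have zn3 := z (-3) (by norm_num)
  have e0 := e 0
  -- All lags beyond two drop out by disjoint supports, and the coefficient at lag two is zero, so
  -- `k = 0, 1, 2` give a closed system.
  have e1 := e 1
  have e2 := e 2
  norm_num [-inner_conj_symm, z3, z4, z5, z6, z7, zn3, n1, n2] at e0 e1 e2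
  push_cast
  refine ⟨?_, ?_, ?_⟩
  · linear_combination e2 + inner ℂ φ (dilTrans 0 2 φ) * h2
  · linear_combination e1 + inner ℂ φ (dilTrans 0 2 φ) * h1 + inner ℂ φ (dilTrans 0 0 φ) * h2
  · linear_combination -e0 - inner ℂ φ (dilTrans 0 0 φ) * h1 - (inner ℂ φ (dilTrans 0 2 φ) +
      (starRingEnd ℂ) (inner ℂ φ (dilTrans 0 2 φ))) * h2

/-- Away from `sin θ = 1`, Lawton's criterion: the translates are mutually orthogonal. -/
theorem correlation_eq_zero (hs : IsSupported φ) (hT : scalingOp θ φ = φ)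
    (hθ : Real.sin θ ≠ 1) {k : ℤ} (hk : k ≠ 0) : inner ℂ φ (dilTrans 0 k φ) = 0 := by
  obtain ⟨e2, e1, -⟩ := correlation_eqs hs hT
  obtain ⟨c3, c1⟩ := sum_coeff_products θ
  rw [c3] at e2
  rw [c3, c1] at e1
  have hlt : Real.sin θ < 1 := lt_of_le_of_ne (Real.sin_le_one θ) hθ
  have hge := Real.neg_one_le_sin θ
  set s := Real.sin θ
  set x := inner ℂ φ (dilTrans 0 1 φ)
  rw [e2] at e1
  have hre := congrArg Complex.re e1
  have him := congrArg Complex.im e1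
  simp only [Complex.add_re, Complex.add_im, Complex.re_ofReal_mul, Complex.im_ofReal_mul,
    Complex.conj_re, Complex.conj_im] at hre him
  -- Eliminating lag two leaves `x/2 = (s(1+s)/4) · conj x`. For `|s| ≤ 1` the factor for the real
  -- part vanishes only at `s = 1`, the one for the imaginary part never.
  have hre' : (1 - s) * (2 + s) * x.re = 0 := by linear_combination 4 * hre
  have him' : (2 + s + s ^ 2) * x.im = 0 := by linear_combination 4 * him
  have x1 : x.re = 0 := by
    rcases mul_eq_zero.1 hre' with h | h
    · exact absurd h (mul_ne_zero (by linarith) (by linarith))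
    · exact h
  have x2 : x.im = 0 := by
    rcases mul_eq_zero.1 him' with h | h
    · nlinarith [sq_nonneg s]
    · exact h
  have hx : x = 0 := Complex.ext x1 x2
  rw [hx, mul_zero] at e2
  have hpos : ∀ k : ℤ, 0 < k → inner ℂ φ (dilTrans 0 k φ) = 0 := fun k hk => by
    by_cases h3 : 3 ≤ k
    · exact hs.inner_dilTrans_eq_zero (h3.trans (le_abs_self k))
    obtain rfl | rfl : k = 1 ∨ k = 2 := by omega
    · exact hx
    · exact e2
  rcases lt_or_gt_of_ne hk with h | h
  · rw [← neg_neg k, inner_dilTrans_neg, hpos _ (by omega), map_zero]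
  · exact hpos k h

/-- In `‖ψ‖²` the alternating signs reverse the lag-one contribution to `‖φ‖²`, and the third
identity of `correlation_eqs` says that this contribution is zero. No orthogonality is needed, so
`sin θ = 1` is covered. -/
theorem norm_mother (hs : IsSupported φ) (hT : scalingOp θ φ = φ) : ‖mother θ φ‖ = ‖φ‖ := by
  obtain ⟨-, -, e0⟩ := correlation_eqs hs hT
  have h1 : (coeff θ 0 : ℂ) ^ 2 + (coeff θ 1 : ℂ) ^ 2 + (coeff θ 2 : ℂ) ^ 2 + (coeff θ 3 : ℂ) ^ 2 = 1 := by
    exact_mod_cast sum_coeff_sq θ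
  have h2 : (coeff θ 0 : ℂ) * coeff θ 2 + coeff θ 1 * coeff θ 3 = 0 := by
    exact_mod_cast (coeff_sq_add_sq θ).2.2.1
  have e := inner_sum_dilTrans (fun i : Fin 4 => (-1) ^ (i : ℕ) * (coeff θ i.rev : ℂ))
    (fun i : Fin 4 => (-1) ^ (i : ℕ) * (coeff θ i.rev : ℂ)) φ 0
  change inner ℂ (mother θ φ) (dilTrans 0 0 (mother θ φ)) = _ at e
  have v3 : ((3 : Fin 4) : ℕ) = 3 := rfl
  have r0 : Fin.rev (0 : Fin 4) = 3 := rfl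
  have r1 : Fin.rev (1 : Fin 4) = 2 := rfl
  have r2 : Fin.rev (2 : Fin 4) = 1 := rfl
  have r3 : Fin.rev (3 : Fin 4) = 0 := rfl
  simp only [Fin.sum_univ_four, Fin.val_zero, Fin.val_one, Fin.val_two, v3, Nat.cast_zero,
    Nat.cast_one, Nat.cast_ofNat, r0, r1, r2, r3] at e
  have n1 := inner_dilTrans_neg φ 1
  have n2 := inner_dilTrans_neg φ 2
  have z3 := hs.inner_dilTrans_eq_zero (k := 3) (by norm_num)
  have zn3 := hs.inner_dilTrans_eq_zero (k := -3) (by norm_num)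
  norm_num [-inner_conj_symm, -inner_self_eq_norm_sq_to_K, z3, zn3, n1, n2, dilTrans_zero_zero] at e
  push_cast at e0
  have h : inner ℂ (mother θ φ) (mother θ φ) = inner ℂ φ φ := by
    linear_combination e - e0 + inner ℂ φ φ * h1 + (inner ℂ φ (dilTrans 0 2 φ) +
      (starRingEnd ℂ) (inner ℂ φ (dilTrans 0 2 φ))) * h2
  rw [norm_eq_sqrt_re_inner (𝕜 := ℂ), norm_eq_sqrt_re_inner (𝕜 := ℂ), h]

/-- If the translates of `φ` are mutually orthogonal, the wavelets are orthogonal to them. -/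
theorem inner_mother_eq_zero (hT : scalingOp θ φ = φ)
    (ho : ∀ k : ℤ, k ≠ 0 → inner ℂ φ (dilTrans 0 k φ) = 0) (j k l : ℤ) :
    inner ℂ (dilTrans j k (mother θ φ)) (dilTrans j l φ) = 0 := by
  rw [inner_dilTrans_dilTrans]
  have e := inner_sum_dilTrans (fun i : Fin 4 => (-1) ^ (i : ℕ) * (coeff θ i.rev : ℂ))
    (fun i : Fin 4 => (coeff θ i : ℂ)) φ (l - k)
  change inner ℂ (mother θ φ) (dilTrans 0 (l - k) (scalingOp θ φ)) = _ at e
  rw [hT] at e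
  rw [e]
  generalize l - k = d
  by_cases hd : d ≠ 0 ∧ d ≠ 1 ∧ d ≠ -1
  · refine Finset.sum_eq_zero fun i _ => Finset.sum_eq_zero fun j _ => ?_
    have hi := i.is_le
    have hj := j.is_le
    rw [ho _ (by omega), mul_zero]
  have v3 : ((3 : Fin 4) : ℕ) = 3 := rfl
  have r0 : Fin.rev (0 : Fin 4) = 3 := rfl
  have r1 : Fin.rev (1 : Fin 4) = 2 := rfl
  have r2 : Fin.rev (2 : Fin 4) = 1 := rfl
  have r3 : Fin.rev (3 : Fin 4) = 0 := rfl
  simp only [Fin.sum_univ_four, Fin.val_zero, Fin.val_one, Fin.val_two, v3, Nat.cast_zero,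
    Nat.cast_one, Nat.cast_ofNat, r0, r1, r2, r3]
  obtain rfl | rfl | rfl : d = 0 ∨ d = 1 ∨ d = -1 := by tauto
  -- The remaining products `± a_{3-i} a_j` cancel in pairs by commutativity alone.
  all_goals
    norm_num [ho]
    ring

/-- Translates at scale `0` are combinations of those at the finer scale `-n`. -/
theorem inner_eq_zero_of_finer (hT : scalingOp θ φ = φ) (g : L2R) (n : ℕ)
    (h : ∀ l : ℤ, inner ℂ (dilTrans (-n) l φ) g = 0) (l : ℤ) : inner ℂ (dilTrans 0 l φ) g = 0 := by
  induction n generalizing l with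
  | zero => simpa using h l
  | succ n ih =>
    refine ih (fun l => ?_) l
    rw [← hT, inner_dilTrans_scalingOp]
    refine Finset.sum_eq_zero fun i _ => ?_
    have := h (2 * l + (i : ℕ))
    rw [Nat.cast_add, Nat.cast_one, neg_add, ← sub_eq_add_neg] at this
    rw [this, mul_zero]

/-- Wavelets at scales `j ≤ 0` are orthogonal to `φ`, so `scaleSum φ (-n) φ` keeps its value `‖φ‖⁴`
at `n = 0`, while its limit is `‖φ‖²`; the integral excludes `φ = 0`. -/
theorem norm_eq_one_of_orthogonal (hs : IsSupported φ) (hT : scalingOp θ φ = φ)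
    (hi : ∫ x, φ x = 1) (ho : ∀ k : ℤ, k ≠ 0 → inner ℂ φ (dilTrans 0 k φ) = 0) : ‖φ‖ = 1 := by
  have hψ : ∀ (n : ℕ) (k : ℤ), inner ℂ (dilTrans (-n) k (mother θ φ)) φ = 0 := fun n k => by
    have h := inner_eq_zero_of_finer hT (dilTrans (-n) k (mother θ φ)) n (fun l => by
      rw [← inner_conj_symm, inner_mother_eq_zero hT ho, map_zero]) 0
    rw [dilTrans_zero_zero] at h
    rw [← inner_conj_symm, h, map_zero]
  have hstep : ∀ n : ℕ, scaleSum φ (-n) φ = scaleSum φ 0 φ := fun n => by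
    induction n with
    | zero => simp
    | succ n ih =>
      have h := hasSum_mother hs hT (-n) φ
      simp only [hψ, norm_zero, ne_eq, OfNat.ofNat_ne_zero, not_false_eq_true, zero_pow] at h
      have h2 := h.unique hasSum_zero
      rw [Nat.cast_add, Nat.cast_one, neg_add, ← sub_eq_add_neg, ← ih]
      linarith
  have h0 : scaleSum φ 0 φ = (‖φ‖ ^ 2) ^ 2 := by
    unfold scaleSum
    rw [tsum_eq_single 0 fun k hk => by
      rw [← inner_conj_symm, ho k hk]
      simp]
    rw [dilTrans_zero_zero, inner_self_eq_ofReal, Complex.norm_real, norm_pow, norm_norm]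
  have hlim := tendsto_scaleSum_neg hs φ
  simp_rw [hstep, h0, hi] at hlim
  have h1 := tendsto_nhds_unique hlim tendsto_const_nhds
  have hne : ‖φ‖ ^ 2 ≠ 0 := by
    intro h
    rw [hs.integral_eq_inner, norm_eq_zero.1 (pow_eq_zero_iff two_ne_zero |>.1 h),
      inner_zero_right] at hi
    exact zero_ne_one hi
  have h2 : ‖φ‖ ^ 2 = 1 := by
    rw [norm_one, one_pow, one_mul, sq (‖φ‖ ^ 2)] at h1
    exact mul_left_cancel₀ hne (by rw [mul_one]; linarith)
  exact (pow_eq_one_iff_of_nonneg (norm_nonneg _) two_ne_zero).1 h2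

theorem coeff_of_sin_eq_one (hθ : Real.sin θ = 1) :
    coeff θ 0 = (√2)⁻¹ ∧ coeff θ 1 = 0 ∧ coeff θ 2 = 0 ∧ coeff θ 3 = (√2)⁻¹ := by
  have hc : Real.cos θ = 0 := by
    have := Real.sin_sq_add_cos_sq θ
    rw [hθ] at this
    nlinarith
  simp only [coeff, Matrix.cons_val, hθ, hc]
  refine ⟨?_, ?_, ?_, ?_⟩ <;> field_simp <;> norm_num

/-- The two dilates are the indicators of `(0, 3/2]` and `(3/2, 3]`, which partition `(0, 3]`. -/
theorem scalingOp_box (hθ : Real.sin θ = 1) : scalingOp θ (box 0 3) = box 0 3 := by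
  obtain ⟨c0, c1, c2, c3⟩ := coeff_of_sin_eq_one hθ
  have h2 : (2 : ℝ) ^ (-((-1 : ℤ) : ℝ) / 2) = √2 := by
    rw [Real.sqrt_eq_rpow]
    norm_num
  have e : scalingOp θ (box 0 3) = (((√2)⁻¹ : ℝ) : ℂ) • dilTrans (-1) 0 (box 0 3) +
      (((√2)⁻¹ : ℝ) : ℂ) • dilTrans (-1) 3 (box 0 3) := by
    unfold scalingOp
    rw [Fin.sum_univ_four, c0, c1, c2, c3]
    simp
  rw [e]
  apply Lp.ext
  filter_upwards [Lp.coeFn_add ((((√2)⁻¹ : ℝ) : ℂ) • dilTrans (-1) 0 (box 0 3))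
      ((((√2)⁻¹ : ℝ) : ℂ) • dilTrans (-1) 3 (box 0 3)),
    Lp.coeFn_smul (((√2)⁻¹ : ℝ) : ℂ) (dilTrans (-1) 0 (box 0 3)),
    Lp.coeFn_smul (((√2)⁻¹ : ℝ) : ℂ) (dilTrans (-1) 3 (box 0 3)),
    coeFn_dilTrans (-1) 0 (box 0 3), coeFn_dilTrans (-1) 3 (box 0 3), coeFn_box 0 3,
    ae_comp_affine (coeFn_box 0 3) (two_zpow_ne_zero (- -1)) ((0 : ℤ) : ℝ),
    ae_comp_affine (coeFn_box 0 3) (two_zpow_ne_zero (- -1)) ((3 : ℤ) : ℝ)]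
    with x h3 h4 h5 h6 h7 h8 h9 h10
  have hm : ∀ w : ℂ, (((√2)⁻¹ : ℝ) : ℂ) • ((√2 : ℝ) * w) = w := fun w => by
    rw [smul_eq_mul, ← mul_assoc, ← Complex.ofReal_mul, inv_mul_cancel₀ (by positivity)]
    simp
  rw [h3, Pi.add_apply, h4, h5, Pi.smul_apply, Pi.smul_apply, h6, h7, h8, h9, h10, h2, hm, hm]
  simp only [Set.indicator_apply, Set.mem_Ioc]
  norm_num
  have b1 : (3 < 2 * x) = ¬ (2 * x ≤ 3) := by simp
  have b2 : (2 * x ≤ 6) = (x ≤ 3) := propext ⟨fun _ => by linarith, fun _ => by linarith⟩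
  simp only [b1, b2]
  by_cases a1 : 0 < x <;> by_cases a2 : x ≤ 3 <;> by_cases a3 : 2 * x ≤ 3
  all_goals first
    | exfalso; linarith
    | simp only [a1, a2, a3, and_true, and_false, if_true, if_false,
        not_true_eq_false, not_false_eq_true, add_zero, zero_add]

/-- For `sin θ = 1` every scaling function equals the normalized indicator function of `[0,3]`. -/
theorem norm_ne_one_of_sin_eq_one (hs : IsSupported φ) (hT : scalingOp θ φ = φ)
    (hi : ∫ x, φ x = 1) (hθ : Real.sin θ = 1) : ‖φ‖ ≠ 1 := by
  set χ : L2R := (3⁻¹ : ℂ) • box 0 3 with hχ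
  have hχs : IsSupported χ := (isSupported_box le_rfl).smul _
  have hχT : scalingOp θ χ = χ := by
    rw [← scalingCLM_apply, hχ, map_smul, scalingCLM_apply, scalingOp_box hθ]
  have hb : inner ℂ (box 0 3) (box 0 3) = 3 := by
    rw [inner_self_eq_ofReal, norm_sq_box (by norm_num)]
    norm_num
  -- The difference solves the scaling equation with zero integral, so it vanishes.
  have hd : φ - χ = 0 := by
    refine eq_zero_of_scalingOp (θ := θ) (hs.sub hχs) ?_ ?_
    · rw [← scalingCLM_apply, map_sub, scalingCLM_apply, scalingCLM_apply, hT, hχT]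
    · rw [(hs.sub hχs).integral_eq_inner, inner_sub_right, ← hs.integral_eq_inner, hi, hχ,
        inner_smul_right, hb]
      norm_num
  rw [sub_eq_zero.1 hd]
  intro h
  have h2 : ‖χ‖ ^ 2 = 1 / 3 := by
    rw [hχ, norm_smul, mul_pow, norm_sq_box (by norm_num)]
    norm_num
  rw [h] at h2
  norm_num at h2

end FixedPoint

/-! ### Parseval frames of unit vectors. -/

section HilbertSpace

variable {ι H : Type*} [NormedAddCommGroup H] [InnerProductSpace ℂ H] [CompleteSpace H]

/-- A Parseval frame of unit vectors is an orthonormal basis. -/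
theorem isOrthonormalBasis_of_parseval {v : ι → H}
    (hv : ∀ f : H, HasSum (fun i => ‖inner ℂ (v i) f‖ ^ 2) (‖f‖ ^ 2)) (h1 : ∀ i, ‖v i‖ = 1) :
    IsOrthonormalBasis v := by
  classical
  have ho : Orthonormal ℂ v := by
    refine ⟨h1, fun i j hij => ?_⟩
    -- The term `i = j` already exhausts `‖v j‖² = 1`.
    have h := sum_le_hasSum {i, j} (fun _ _ => by positivity) (hv (v j))
    rw [Finset.sum_pair hij, inner_self_eq_norm_sq_to_K, h1] at h
    have h2 : ‖inner ℂ (v i) (v j)‖ ^ 2 ≤ 0 := by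
      simpa using h
    simpa using h2
  have hb : (Submodule.span ℂ (Set.range v))ᗮ = ⊥ := by
    rw [Submodule.eq_bot_iff]
    intro f hf
    have h0 : ∀ i, inner ℂ (v i) f = 0 := fun i =>
      (Submodule.mem_orthogonal _ _).1 hf _ (Submodule.subset_span ⟨i, rfl⟩)
    have h := hv f
    simp only [h0, norm_zero, ne_eq, OfNat.ofNat_ne_zero, not_false_eq_true, zero_pow] at h
    have h2 := h.unique hasSum_zero
    simpa using h2
  exact ⟨HilbertBasis.mkOfOrthogonalEqBot ho hb, HilbertBasis.coe_mkOfOrthogonalEqBot ho hb⟩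

end HilbertSpace

/-! ### Zeros of the low-pass filter and cycles. -/

section LowPass

variable {θ : ℝ}

theorem lowPass_eq (θ : ℝ) (z : ℂ) : lowPass θ z =
    coeff θ 0 + coeff θ 1 * z + coeff θ 2 * z ^ 2 + coeff θ 3 * z ^ 3 := by
  simp [lowPass, Fin.sum_univ_four]

/-- Splitting into even and odd powers gives `m₀(±z) = P(z²) ± z Q(z²)`. The parallelogram law
reduces the claim to `|P|² + |Q|² = 1`, which follows from the unit sum of squares and the
orthogonality at lag two. -/
theorem norm_sq_lowPass (θ : ℝ) (z : Circle) :
    ‖lowPass θ z‖ ^ 2 + ‖lowPass θ (-(z : ℂ))‖ ^ 2 = 2 := by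
  have hw : ((z : ℂ) ^ 2).re ^ 2 + ((z : ℂ) ^ 2).im ^ 2 = 1 := by
    have := Circle.normSq_coe (z ^ 2)
    rw [Complex.normSq_apply, Circle.coe_pow] at this
    linarith
  set w := (z : ℂ) ^ 2 with hwz
  have e1 : lowPass θ z = (coeff θ 0 + coeff θ 2 * w) + z * (coeff θ 1 + coeff θ 3 * w) := by
    rw [lowPass_eq, hwz]
    ring
  have e2 : lowPass θ (-(z : ℂ)) =
      (coeff θ 0 + coeff θ 2 * w) - z * (coeff θ 1 + coeff θ 3 * w) := by
    rw [lowPass_eq, hwz]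
    ring
  have hp := parallelogram_law_with_norm ℝ ((coeff θ 0 : ℂ) + coeff θ 2 * w)
    (z * (coeff θ 1 + coeff θ 3 * w))
  rw [← e1, ← e2, norm_mul, Circle.norm_coe, one_mul] at hp
  rw [hp, Complex.sq_norm, Complex.sq_norm, Complex.normSq_apply, Complex.normSq_apply]
  simp only [Complex.add_re, Complex.add_im, Complex.re_ofReal_mul, Complex.im_ofReal_mul,
    Complex.ofReal_re, Complex.ofReal_im]
  have h1 := sum_coeff_sq θ
  have h2 := (coeff_sq_add_sq θ).2.2.1
  linear_combination 2 * h1 + 4 * w.re * h2 + 2 * (coeff θ 2 ^ 2 + coeff θ 3 ^ 2) * hw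

theorem norm_lowPass_eq_iff (θ : ℝ) :
    {z : Circle | ‖lowPass θ (z : ℂ)‖ = √2} = zeroSet θ := by
  ext z
  have h := norm_sq_lowPass θ z
  have h2 : √2 ^ 2 = 2 := Real.sq_sqrt (by norm_num)
  simp only [zeroSet, Set.mem_ofPred_eq]
  constructor
  · intro hz
    rw [hz, h2] at h
    have : ‖lowPass θ (-(z : ℂ))‖ ^ 2 = 0 := by linarith
    simpa using this
  · intro hz
    rw [hz, norm_zero] at h
    rw [← Real.sqrt_sq (norm_nonneg (lowPass θ z))]
    congr 1
    linarith

theorem lowPass_of_sin_eq_one (hθ : Real.sin θ = 1) (z : ℂ) :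
    lowPass θ z = (1 + z ^ 3) / ((√2 : ℝ) : ℂ) := by
  obtain ⟨c0, c1, c2, c3⟩ := coeff_of_sin_eq_one hθ
  rw [lowPass_eq, c0, c1, c2, c3]
  push_cast
  ring

theorem zeroSet_of_sin_eq_one (hθ : Real.sin θ = 1) : zeroSet θ = {z : Circle | z ^ 3 = 1} := by
  ext z
  simp only [zeroSet, Set.mem_ofPred_eq, lowPass_of_sin_eq_one hθ]
  rw [div_eq_zero_iff, or_iff_left (by simp), ← Circle.coe_inj, Circle.coe_pow, Circle.coe_one]
  constructor
  · intro h
    linear_combination -h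
  · intro h
    linear_combination -h

/-- Away from `z = 1` a zero is a root of the quadratic cofactor of `1 - z`. Multiplying by `conj z`
and separating parts gives `(1 + sin θ) Re z + sin θ = 0` and `cos θ · Im z = 0`, incompatible
unless `sin θ = 1`. -/
theorem zeroSet_subset (hθ : Real.sin θ ≠ 1) : zeroSet θ ⊆ {1} := by
  intro z hz
  by_contra hne
  rw [Set.mem_singleton_iff, ← Circle.coe_inj, Circle.coe_one] at hne
  have hnorm : (z : ℂ) * (starRingEnd ℂ) (z : ℂ) = 1 := by
    rw [Complex.mul_conj, Circle.normSq_coe, Complex.ofReal_one]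
  have hz' : (z : ℂ).re ^ 2 + (z : ℂ).im ^ 2 = 1 := by
    have := Circle.normSq_coe z
    rw [Complex.normSq_apply] at this
    linarith
  have h0 : lowPass θ (-(z : ℂ)) = 0 := hz
  have hr : √2 * √2 = 2 := Real.mul_self_sqrt (by norm_num)
  have hc : √2 * coeff θ 0 = (1 - Real.cos θ + Real.sin θ) / 2 ∧
      √2 * coeff θ 1 = (1 - Real.cos θ - Real.sin θ) / 2 ∧
      √2 * coeff θ 2 = (1 + Real.cos θ - Real.sin θ) / 2 ∧
      √2 * coeff θ 3 = (1 + Real.cos θ + Real.sin θ) / 2 := by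
    simp only [coeff, Matrix.cons_val]
    refine ⟨?_, ?_, ?_, ?_⟩ <;> field_simp
  obtain ⟨c0, c1, c2, c3⟩ := hc
  set s := Real.sin θ with hs
  set c := Real.cos θ with hcc
  have hcs : s ^ 2 + c ^ 2 = 1 := Real.sin_sq_add_cos_sq θ
  have hfac : (1 - (z : ℂ)) * ((((1 - c + s) / 2 : ℝ) : ℂ) + (s : ℂ) * z +
      (((1 + c + s) / 2 : ℝ) : ℂ) * (z : ℂ) ^ 2) = 0 := by
    have e : (√2 : ℂ) * lowPass θ (-(z : ℂ)) = (1 - (z : ℂ)) * ((((1 - c + s) / 2 : ℝ) : ℂ) +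
        (s : ℂ) * z + (((1 + c + s) / 2 : ℝ) : ℂ) * (z : ℂ) ^ 2) := by
      have d0 := congrArg (fun x : ℝ => (x : ℂ)) c0
      have d1 := congrArg (fun x : ℝ => (x : ℂ)) c1
      have d2 := congrArg (fun x : ℝ => (x : ℂ)) c2
      have d3 := congrArg (fun x : ℝ => (x : ℂ)) c3
      push_cast at d0 d1 d2 d3 ⊢
      rw [lowPass_eq]
      linear_combination d0 - z * d1 + (z : ℂ) ^ 2 * d2 - (z : ℂ) ^ 3 * d3
    rw [← e, h0, mul_zero]
  have hq := (mul_eq_zero.1 hfac).resolve_left (sub_ne_zero.2 (Ne.symm hne))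
  have hq2 : (((1 - c + s) / 2 : ℝ) : ℂ) * (starRingEnd ℂ) (z : ℂ) + (s : ℂ) +
      (((1 + c + s) / 2 : ℝ) : ℂ) * (z : ℂ) = 0 := by
    linear_combination (starRingEnd ℂ) (z : ℂ) * hq -
      ((s : ℂ) + (((1 + c + s) / 2 : ℝ) : ℂ) * z) * hnorm
  have hre := congrArg Complex.re hq2
  have him := congrArg Complex.im hq2
  simp only [Complex.add_re, Complex.add_im, Complex.re_ofReal_mul, Complex.im_ofReal_mul,
    Complex.conj_re, Complex.conj_im, Complex.ofReal_re, Complex.ofReal_im, Complex.zero_re,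
    Complex.zero_im] at hre him
  have hre' : (1 + s) * (z : ℂ).re + s = 0 := by linear_combination hre
  have him' : c * (z : ℂ).im = 0 := by linear_combination him
  rcases mul_eq_zero.1 him' with hc0 | hy
  · have : (s - 1) * (s + 1) = 0 := by
      rw [hc0] at hcs
      linear_combination hcs
    rcases mul_eq_zero.1 this with h | h
    · exact hθ (by linarith)
    · have : s = -1 := by linarith
      rw [this] at hre'
      norm_num at hre'
  · rw [hy] at hz'
    have : ((z : ℂ).re - 1) * ((z : ℂ).re + 1) = 0 := by linear_combination hz'
    rcases mul_eq_zero.1 this with h | h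
    · exact hne (Complex.ext (by simpa using by linarith) (by simpa using hy))
    · have h1 : (z : ℂ).re = -1 := by linarith
      rw [h1] at hre'
      linarith

theorem exists_nontrivial_cycle_iff (θ : ℝ) :
    (∃ C : Set Circle, IsNontrivialCycle C ∧ C ⊆ zeroSet θ) ↔ Real.sin θ = 1 := by
  constructor
  · rintro ⟨C, ⟨⟨n, z, hn, -, -, -, rfl⟩, hne⟩, hC⟩
    by_contra hθ
    refine hne ?_
    refine Set.Nonempty.subset_singleton_iff ?_ |>.1 (hC.trans (zeroSet_subset hθ))
    exact ⟨z 0, 0, hn, rfl⟩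
  · intro hθ
    have hω := Complex.isPrimitiveRoot_exp 3 (by norm_num)
    set ω : Circle := Circle.exp (2 * Real.pi / 3) with hωdef
    have hcoe : (ω : ℂ) = Complex.exp (2 * Real.pi * Complex.I / (3 : ℕ)) := by
      rw [hωdef, Circle.coe_exp]
      congr 1
      push_cast
      ring
    have h3 : ω ^ 3 = 1 := by
      rw [← Circle.coe_inj, Circle.coe_pow, hcoe, hω.pow_eq_one, Circle.coe_one]
    have h1 : ω ≠ 1 := by
      intro h
      have := hω.ne_one (by norm_num)
      rw [← hcoe, h, Circle.coe_one] at this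
      exact this rfl
    have h21 : ω ^ 2 ≠ ω := by
      intro h
      rw [sq] at h
      exact h1 (mul_eq_left.1 h)
    -- The cycle is `{ω, ω²}` for a primitive cube root of unity; it closes because `ω⁴ = ω`.
    refine ⟨_, ⟨⟨2, fun i => ω ^ 2 ^ i, two_pos, fun i => ?_, ?_, ?_, rfl⟩, ?_⟩, ?_⟩
    · exact (congrArg (ω ^ ·) (pow_succ 2 i)).trans (pow_mul ω _ 2)
    · change ω ^ 4 = ω ^ 1
      rw [pow_succ, h3, one_mul, pow_one]
    · intro i hi j hj hij
      simp only [Set.mem_ofPred_eq] at hi hj hij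
      interval_cases i <;> interval_cases j
      · rfl
      · exact absurd hij.symm (by simpa using h21)
      · exact absurd hij (by simpa using h21)
      · rfl
    · intro h
      have : ω ^ 2 ^ 0 ∈ ({1} : Set Circle) := h ▸ Set.mem_image_of_mem (fun i : ℕ => ω ^ 2 ^ i) (show 0 ∈ {i : ℕ | i < 2} from Nat.two_pos)
      exact h1 (by simpa using this)
    · rintro _ ⟨i, -, rfl⟩
      rw [zeroSet_of_sin_eq_one hθ, Set.mem_ofPred_eq, ← pow_mul, mul_comm, pow_mul, h3, one_pow]

end LowPass

/-! ### The dichotomy for scaling functions. -/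

section ScalingFunction

variable {θ : ℝ} {φ : L2R}

theorem IsScalingFunction.hasSum_wavelet (h : IsScalingFunction θ φ) (f : L2R) :
    HasSum (fun p => ‖inner ℂ (waveletSystem θ φ p) f‖ ^ 2) (‖f‖ ^ 2) := by
  obtain ⟨hs, hT, hi⟩ := (isScalingFunction_iff θ φ).1 h
  have := hasSum_mother_all hs hT f
  rwa [hi, norm_one, one_pow, one_mul] at this

theorem IsScalingFunction.isTightFrame (h : IsScalingFunction θ φ) :
    IsTightFrame (waveletSystem θ φ) :=
  ⟨1, one_pos, fun f => by simpa only [one_mul] using h.hasSum_wavelet f⟩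

theorem IsScalingFunction.norm_eq_one_iff (h : IsScalingFunction θ φ) :
    ‖φ‖ = 1 ↔ Real.sin θ ≠ 1 := by
  obtain ⟨hs, hT, hi⟩ := (isScalingFunction_iff θ φ).1 h
  exact ⟨fun h1 hθ => norm_ne_one_of_sin_eq_one hs hT hi hθ h1, fun hθ =>
    norm_eq_one_of_orthogonal hs hT hi fun k hk => correlation_eq_zero hs hT hθ hk⟩

theorem IsScalingFunction.norm_waveletSystem (h : IsScalingFunction θ φ) (p : ℤ × ℤ) :
    ‖waveletSystem θ φ p‖ = ‖φ‖ := by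
  obtain ⟨hs, hT, -⟩ := (isScalingFunction_iff θ φ).1 h
  exact (norm_dilTrans _ _ _).trans (norm_mother hs hT)

theorem IsScalingFunction.isOrthonormalBasis_iff (h : IsScalingFunction θ φ) :
    IsOrthonormalBasis (waveletSystem θ φ) ↔ Real.sin θ ≠ 1 := by
  rw [← h.norm_eq_one_iff]
  constructor
  · rintro ⟨b, hb⟩
    rw [← h.norm_waveletSystem (0, 0), ← hb]
    exact b.orthonormal.1 _
  · intro h1
    exact isOrthonormalBasis_of_parseval h.hasSum_wavelet fun p => by
      rw [h.norm_waveletSystem, h1]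

/-- Orthogonality without normalization suffices: it already forces `‖φ‖ = 1`, which excludes `sin θ
= 1`. -/
theorem IsScalingFunction.pairwise_orthogonal_iff (h : IsScalingFunction θ φ) :
    Pairwise (fun k l : ℤ => inner ℂ (translates φ k) (translates φ l) = 0) ↔
      Real.sin θ ≠ 1 := by
  obtain ⟨hs, hT, hi⟩ := (isScalingFunction_iff θ φ).1 h
  constructor
  · intro ho
    rw [← h.norm_eq_one_iff]
    refine norm_eq_one_of_orthogonal hs hT hi fun k hk => ?_
    have := ho (Ne.symm hk)
    simpa only [translates, dilTrans_zero_zero] using this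
  · intro hθ k l hkl
    rw [translates, translates, inner_dilTrans_dilTrans]
    exact correlation_eq_zero hs hT hθ (sub_ne_zero.2 (Ne.symm hkl))

theorem IsScalingFunction.orthonormal_iff (h : IsScalingFunction θ φ) :
    Orthonormal ℂ (translates φ) ↔ Real.sin θ ≠ 1 := by
  constructor
  · intro ho
    exact h.pairwise_orthogonal_iff.1 ho.2
  · intro hθ
    refine ⟨fun k => ?_, h.pairwise_orthogonal_iff.2 hθ⟩
    rw [translates, norm_dilTrans, h.norm_eq_one_iff]
    exact hθ

end ScalingFunction

theorem sin_eq_one_iff_exists (θ : ℝ) :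
    Real.sin θ = 1 ↔ ∃ n : ℤ, θ = Real.pi / 2 + 2 * Real.pi * n := by
  rw [Real.sin_eq_one_iff]
  refine exists_congr fun n => ?_
  rw [eq_comm, mul_comm (n : ℝ)]

end GenusTwo

theorem mainTheorem5 (θ : ℝ) :
    {z : Circle | ‖GenusTwo.lowPass θ (z : ℂ)‖ = √2} = GenusTwo.zeroSet θ ∧
    ((∃ C : Set Circle, GenusTwo.IsNontrivialCycle C ∧ C ⊆ GenusTwo.zeroSet θ) ↔
      ∃ n : ℤ, θ = Real.pi / 2 + 2 * Real.pi * n) ∧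
    ((∃ n : ℤ, θ = Real.pi / 2 + 2 * Real.pi * n) →
      (∀ z : ℂ, GenusTwo.lowPass θ z = (1 + z ^ 3) / ((√2 : ℝ) : ℂ)) ∧
      GenusTwo.zeroSet θ = {z : Circle | z ^ 3 = 1}) ∧
    (∃ φ : GenusTwo.L2R, GenusTwo.IsScalingFunction θ φ) ∧
    ∀ φ : GenusTwo.L2R, GenusTwo.IsScalingFunction θ φ →
      GenusTwo.IsTightFrame (GenusTwo.waveletSystem θ φ) ∧
      (GenusTwo.IsOrthonormalBasis (GenusTwo.waveletSystem θ φ) ↔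
        ¬ ∃ n : ℤ, θ = Real.pi / 2 + 2 * Real.pi * n) ∧
      (Orthonormal ℂ (GenusTwo.translates φ) ↔
        ¬ ∃ n : ℤ, θ = Real.pi / 2 + 2 * Real.pi * n) ∧
      (Pairwise (fun k l : ℤ =>
          inner ℂ (GenusTwo.translates φ k) (GenusTwo.translates φ l) = 0) ↔
        ¬ ∃ n : ℤ, θ = Real.pi / 2 + 2 * Real.pi * n) := by
  rw [← GenusTwo.sin_eq_one_iff_exists]
  refine ⟨GenusTwo.norm_lowPass_eq_iff θ, GenusTwo.exists_nontrivial_cycle_iff θ,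
    fun hθ => ⟨GenusTwo.lowPass_of_sin_eq_one hθ, GenusTwo.zeroSet_of_sin_eq_one hθ⟩, ?_,
    fun φ h => ⟨h.isTightFrame, h.isOrthonormalBasis_iff, h.orthonormal_iff,
      h.pairwise_orthogonal_iff⟩⟩
  obtain ⟨φ, hφ⟩ := GenusTwo.exists_fixedPoint θ
  exact ⟨φ, (GenusTwo.isScalingFunction_iff θ φ).2 hφ⟩
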